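/- Let $B=\{x\in\mathbb R^2:|x|<1\}$ and let $\alpha\ge 0$ be fixed. For $p>1$, a solution of the Hénon problem is a function $u\in C^2(B)\cap C(\overline B)$ with $$-\Delta u=|x|^{\alpha}|u|^{p-1}u\ \text{ in } B,\qquad u=0\ \text{ on }\partial B .$$ Its nodal regions are the connected components of $\{x\in B: u(x)\neq 0\}$, and its energy is $$\mathcal E_p(u)=\frac12\int_B|\nabla u|^2\,dx-\frac1{p+1}\int_B|x|^{\alpha}|u|^{p+1}\,dx .$$ Let $N\ge 0$ be an integer, and for every sufficiently large real $p$ let $u_p$ be a solution of the Hénon problem with exponent $p$ that has at least $N$ nodal regions. Then, for all sufficiently large $p$, both integrals in $\mathcal E_p(u_p)$ are finite, and $$\liminf_{p\to\infty}\,p\,\mathcal E_p(u_p)\ \ge\ 4\pi e N ,$$ where the lower limit is taken in $[-\infty,+\infty]$. -/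

import Mathlib

open MeasureTheory Filter Topology

/-- The open unit disc of the Euclidean plane. -/
def unitDisc : Set (EuclideanSpace ℝ (Fin 2)) := Metric.ball 0 1

/-- `u` is a (classical) solution of the Hénon problem with parameters `α` and `p`:
`-Δ u = |x| ^ α |u| ^ (p - 1) u` in the unit disc, `u = 0` on its boundary, where `u` is of class
`C²` in the disc and continuous up to the boundary. The values of `u` outside the closed disc
play no role. -/
structure IsHenonSolution (α p : ℝ) (u : EuclideanSpace ℝ (Fin 2) → ℝ) : Prop where
  contDiffOn : ContDiffOn ℝ 2 u unitDisc
  continuousOn : ContinuousOn u (closure unitDisc)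
  equation : ∀ x ∈ unitDisc, -(Laplacian.laplacian u x) = ‖x‖ ^ α * |u x| ^ (p - 1) * u x
  boundary : ∀ x ∈ frontier unitDisc, u x = 0

/-- The nodal regions of `u`: the connected components of `{x ∈ B : u x ≠ 0}`. -/
def nodalRegions (u : EuclideanSpace ℝ (Fin 2) → ℝ) : Set (Set (EuclideanSpace ℝ (Fin 2))) :=
  {Ω | ∃ x ∈ {y ∈ unitDisc | u y ≠ 0}, Ω = connectedComponentIn {y ∈ unitDisc | u y ≠ 0} x}

/-- The energy `E_p(u) = 1/2 ∫_B |∇u|² - 1/(p+1) ∫_B |x| ^ α |u| ^ (p + 1)`. -/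
noncomputable def henonEnergy (α p : ℝ) (u : EuclideanSpace ℝ (Fin 2) → ℝ) : ℝ :=
  1 / 2 * (∫ x in unitDisc, ‖gradient u x‖ ^ 2)
    - 1 / (p + 1) * ∫ x in unitDisc, ‖x‖ ^ α * |u x| ^ (p + 1)

/-! Each nodal region `Ω` contributes separately. On `Ω` the sign of `u` is constant, so take `u >
0` and put `f = |x|^α u^p`, `M = ∫_Ω f`, `J = ∫_Ω f u`. The target is a lower bound for `(p + 1) J`
tending to `4πse`, for every `s < 2`.

The function `u` lies below the Newtonian potential of `f`: `2π u(a) ≤ ∫_Ω f(y) log (3/|y - a|) dy`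
(`two_pi_mul_le_of_newtonian_potential_le`, with a regularised kernel). By the duality between `t
log t` and `exp`, `s` times this potential is at most `∫ f log f - M log M + C_s M`, where `C_s =
∫_{|z|<2} (3/|z|)^s` is finite exactly because `s < 2` (`setIntegral_mul_newtonKernel_le`). Since
`|x|^α ≤ 1`, Jensen's inequality gives `∫ f log f ≤ p M log (J/M)`. Multiplying the pointwise bound
by `f` and integrating yields `2πsJ ≤ M² (p log (J/M) - log M + C_s)`. A tangent line for the
logarithm removes `M` (`log_energy_bound`), which leaves the bound on `(p + 1) J`.

Globally, testing the equation with truncations of `u` gives `∫ |∇u|² ≥ ∫ |x|^α |u|^(p+1)`, so the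
energy is at least `(1/2 - 1/(p+1))` times the sum of the `J`'s over `N` regions. Letting `p → ∞`
and then `s → 2` gives `N · (1/2) · 8πe`.

Nodal regions may have irregular boundaries, so there is no integration by parts on `Ω`: `u` is
replaced by `h(u)` with `h = 0` on `(-∞, ε]`, which extends by zero to a compactly supported `C²`
function on the plane. -/

theorem fderiv_comp_scalar {E : Type*} [NormedAddCommGroup E] [NormedSpace ℝ E]
    {f : E → ℝ} {h : ℝ → ℝ} {x : E} (hf : DifferentiableAt ℝ f x)
    (hh : DifferentiableAt ℝ h (f x)) :
    fderiv ℝ (h ∘ f) x = deriv h (f x) • fderiv ℝ f x :=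
  (hh.hasDerivAt.comp_hasFDerivAt x hf.hasFDerivAt).fderiv

/-! ### Laplacian identities and integration by parts on the whole space. -/

section Calculus

variable {E : Type*} [NormedAddCommGroup E] [InnerProductSpace ℝ E] [FiniteDimensional ℝ E]

/-- Chain rule for the Laplacian. -/
theorem laplacian_comp {f : E → ℝ} {h : ℝ → ℝ} {x : E} (hf : ContDiffAt ℝ 2 f x)
    (hh : ContDiffAt ℝ 2 h (f x)) :
    Laplacian.laplacian (h ∘ f) x = deriv h (f x) * Laplacian.laplacian f x +
      deriv (deriv h) (f x) * ‖gradient f x‖ ^ 2 := by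
  have hh1 : ContDiffAt ℝ 1 (deriv h) (f x) := by
    have : ContDiffAt ℝ 1 (fderiv ℝ h) (f x) := hh.fderiv_right (by norm_num [one_add_one_eq_two])
    simpa only [fderiv_apply_one_eq_deriv] using this.clm_apply (contDiffAt_const (c := (1 : ℝ)))
  have hf1 : ContDiffAt ℝ 1 (fderiv ℝ f) x := hf.fderiv_right (by norm_num [one_add_one_eq_two])
  have hev : fderiv ℝ (h ∘ f) =ᶠ[𝓝 x] fun y => deriv h (f y) • fderiv ℝ f y := by
    filter_upwards [hf.eventually (by simp),
      hf.continuousAt.eventually (hh.eventually (by simp))] with y hy hy'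
    exact fderiv_comp_scalar (hy.differentiableAt (by simp)) (hy'.differentiableAt (by simp))
  have hfx : DifferentiableAt ℝ f x := hf.differentiableAt (by simp)
  have hc : HasFDerivAt (fun y => deriv h (f y)) (deriv (deriv h) (f x) • fderiv ℝ f x) x :=
    ((hh1.differentiableAt (by simp)).hasDerivAt).comp_hasFDerivAt x hfx.hasFDerivAt
  have hd : fderiv ℝ (fderiv ℝ (h ∘ f)) x = _ :=
    hev.fderiv_eq.trans (hc.smul (hf1.differentiableAt (by simp)).hasFDerivAt).fderiv
  simp only [InnerProductSpace.laplacian_eq_iteratedFDeriv_stdOrthonormalBasis,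
    iteratedFDeriv_two_apply, hd]
  have hg : ‖gradient f x‖ ^ 2 = ∑ i, (fderiv ℝ f x (stdOrthonormalBasis ℝ E i)) ^ 2 := by
    rw [← (stdOrthonormalBasis ℝ E).sum_sq_norm_inner_left (gradient f x)]
    refine Finset.sum_congr rfl fun i _ => ?_
    rw [gradient, InnerProductSpace.toDual_symm_apply, Real.norm_eq_abs, sq_abs]
  rw [hg, Finset.mul_sum, Finset.mul_sum, ← Finset.sum_add_distrib]
  refine Finset.sum_congr rfl fun i _ => ?_
  simp
  ring

theorem continuous_laplacian {g : E → ℝ} (hg : ContDiff ℝ 2 g) :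
    Continuous (Laplacian.laplacian g) := by
  rw [InnerProductSpace.laplacian_eq_iteratedFDeriv_stdOrthonormalBasis]
  exact continuous_finsetSum _ fun i _ =>
    (continuous_eval_const _).comp (hg.continuous_iteratedFDeriv (m := 2) le_rfl)

theorem hasCompactSupport_laplacian {g : E → ℝ} (hgc : HasCompactSupport g) :
    HasCompactSupport (Laplacian.laplacian g) := by
  rw [InnerProductSpace.laplacian_eq_iteratedFDeriv_stdOrthonormalBasis]
  refine (hgc.iteratedFDeriv (𝕜 := ℝ) 2).mono fun x hx => ?_
  contrapose! hx
  simp only [Function.mem_support, not_not] at hx ⊢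
  simp [hx]

variable [MeasurableSpace E] [BorelSpace E]

/-- Two integrations by parts in each coordinate; compact support of `g` alone makes every product
integrable, so `L` may grow. -/
theorem integral_mul_laplacian {g L : E → ℝ} (hg : ContDiff ℝ 2 g) (hgc : HasCompactSupport g)
    (hL : ContDiff ℝ 2 L) :
    ∫ x, L x * Laplacian.laplacian g x = ∫ x, Laplacian.laplacian L x * g x := by
  have key : ∀ {f : E → ℝ}, ContDiff ℝ 2 f → ∀ v w : E,
      ContDiff ℝ 1 (fun x => fderiv ℝ f x v) ∧
      Continuous (fun x => fderiv ℝ (fun y => fderiv ℝ f y v) x w) ∧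
      ∀ x, fderiv ℝ (fun y => fderiv ℝ f y v) x w = fderiv ℝ (fderiv ℝ f) x w v := by
    intro f hf v w
    have h1 : ContDiff ℝ 1 (fderiv ℝ f) := hf.fderiv_right (by norm_num [one_add_one_eq_two])
    have h2 : ContDiff ℝ 1 (fun x => fderiv ℝ f x v) := h1.clm_apply contDiff_const
    refine ⟨h2, (h2.continuous_fderiv (by simp)).clm_apply continuous_const, fun x => ?_⟩
    rw [fderiv_clm_apply (h1.differentiable (by simp) x) (by fun_prop)]
    simp
  simp only [InnerProductSpace.laplacian_eq_iteratedFDeriv_stdOrthonormalBasis,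
    iteratedFDeriv_two_apply, Finset.mul_sum, Finset.sum_mul, Matrix.cons_val_zero,
    Matrix.cons_val_one]
  have cs1 : ∀ v, HasCompactSupport (fun x => fderiv ℝ g x v) := fun v =>
    (hgc.fderiv (𝕜 := ℝ)).comp_left (g := fun l : E →L[ℝ] ℝ => l v) (by simp)
  have cs2 : ∀ v, HasCompactSupport (fun x => fderiv ℝ (fun y => fderiv ℝ g y v) x v) := fun v =>
    ((cs1 v).fderiv (𝕜 := ℝ)).comp_left (g := fun l : E →L[ℝ] ℝ => l v) (by simp)
  have i1 : ∀ v, Integrable (fun x => L x * fderiv ℝ (fun y => fderiv ℝ g y v) x v) := fun v =>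
    (hL.continuous.mul (key hg v v).2.1).integrable_of_hasCompactSupport (cs2 v).mul_left
  have i2 : ∀ v, Integrable (fun x => fderiv ℝ L x v * fderiv ℝ g x v) := fun v =>
    ((key hL v v).1.continuous.mul (key hg v v).1.continuous).integrable_of_hasCompactSupport
      (cs1 v).mul_left
  have i3 : ∀ v, Integrable (fun x => fderiv ℝ (fun y => fderiv ℝ L y v) x v * g x) := fun v =>
    ((key hL v v).2.1.mul hg.continuous).integrable_of_hasCompactSupport hgc.mul_left
  have i4 : ∀ v, Integrable (fun x => L x * fderiv ℝ g x v) := fun v =>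
    (hL.continuous.mul (key hg v v).1.continuous).integrable_of_hasCompactSupport
      (cs1 v).mul_left
  have i5 : ∀ v, Integrable (fun x => fderiv ℝ L x v * g x) := fun v =>
    ((key hL v v).1.continuous.mul hg.continuous).integrable_of_hasCompactSupport hgc.mul_left
  rw [integral_finsetSum, integral_finsetSum]
  · refine Finset.sum_congr rfl fun i _ => ?_
    set v := stdOrthonormalBasis ℝ E i
    simp only [← (key hg v v).2.2, ← (key hL v v).2.2]
    rw [integral_mul_fderiv_eq_neg_fderiv_mul_of_integrable (i2 v) (i1 v) (i4 v)
      (fun x _ => hL.differentiable (by simp) x)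
      (fun x _ => (key hg v v).1.differentiable (by simp) x),
      integral_mul_fderiv_eq_neg_fderiv_mul_of_integrable (i3 v) (i2 v) (i5 v)
      (fun x _ => (key hL v v).1.differentiable (by simp) x)
      (fun x _ => hg.differentiable (by simp) x), neg_neg]
  · intro i _
    simpa only [← (key hL _ _).2.2] using i3 _
  · intro i _
    simpa only [← (key hg _ _).2.2] using i1 _

theorem integral_laplacian_eq_zero {g : E → ℝ} (hg : ContDiff ℝ 2 g) (hgc : HasCompactSupport g) :
    ∫ x, Laplacian.laplacian g x = 0 := by
  have := integral_mul_laplacian hg hgc (contDiff_const (c := (1 : ℝ)))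
  have h0 : Laplacian.laplacian (fun _ : E => (1 : ℝ)) = 0 := by
    rw [InnerProductSpace.laplacian_eq_iteratedFDeriv_stdOrthonormalBasis]
    ext x
    simp [iteratedFDeriv_two_apply]
  simpa [h0] using this

/-- The gradient of a function vanishes almost everywhere on its zero set. -/
theorem ae_gradient_eq_zero_of_eqOn_zero {f : E → ℝ} {s : Set E} (hs : MeasurableSet s)
    (hf : ∀ x ∈ s, DifferentiableAt ℝ f x) (h0 : ∀ x ∈ s, f x = 0) :
    ∀ᵐ x ∂volume.restrict s, gradient f x = 0 := by
  rcases subsingleton_or_nontrivial E with hE | hE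
  · exact Eventually.of_forall fun x => Subsingleton.elim _ _
  obtain ⟨v, hv⟩ := exists_ne (0 : E)
  -- The density-point estimate used below concerns maps `E → E`, hence the factor `v ≠ 0`. On `s`
  -- the map is approximated by `0` with error constant `0`, which forces its derivative to vanish
  -- almost everywhere there.
  have hA : ApproximatesLinearOn (fun x => f x • v) (0 : E →L[ℝ] E) s 0 := by
    intro x hx y hy
    simp [h0 x hx, h0 y hy]
  have := hA.norm_fderiv_sub_le volume hs (fun x => (fderiv ℝ f x).smulRight v)
    (fun x hx => ((hf x hx).hasFDerivAt.smul_const v).hasFDerivWithinAt)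
  filter_upwards [this] with x hx
  have h2 : fderiv ℝ f x = 0 := by simpa [hv] using hx
  simp [gradient, h2]

end Calculus

/-! ### Smooth truncations of the real line. -/

section Truncation

/-- The primitive of `f` vanishing at `0`. -/
noncomputable def primitive (f : ℝ → ℝ) (t : ℝ) : ℝ := ∫ s in (0 : ℝ)..t, f s

theorem hasDerivAt_primitive {f : ℝ → ℝ} (hf : Continuous f) (t : ℝ) :
    HasDerivAt (primitive f) (f t) t :=
  intervalIntegral.integral_hasDerivAt_right (hf.intervalIntegrable _ _)
    (hf.stronglyMeasurableAtFilter _ _) hf.continuousAt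

theorem deriv_primitive {f : ℝ → ℝ} (hf : Continuous f) : deriv (primitive f) = f :=
  funext fun t => (hasDerivAt_primitive hf t).deriv

theorem contDiff_primitive {f : ℝ → ℝ} (hf : ContDiff ℝ 2 f) : ContDiff ℝ 2 (primitive f) := by
  have : ContDiff ℝ (1 + 1) (primitive f) := by
    rw [contDiff_succ_iff_deriv, deriv_primitive hf.continuous]
    exact ⟨fun t => (hasDerivAt_primitive hf.continuous t).differentiableAt, by simp,
      hf.of_le (by norm_num)⟩
  simpa [one_add_one_eq_two] using this

theorem primitive_eq_zero {f : ℝ → ℝ} {ε t : ℝ} (hε : 0 ≤ ε) (hf : ∀ s ≤ ε, f s = 0)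
    (ht : t ≤ ε) : primitive f t = 0 := by
  have : ∀ s ∈ Set.uIcc 0 t, f s = 0 := fun s hs => hf s (hs.2.trans (sup_le hε ht))
  rw [primitive, intervalIntegral.integral_congr this]
  simp

/-- A smooth monotone function equal to `0` on `(-∞, ε]` and to `1` on `[2 ε, ∞)`. -/
noncomputable def smoothStep (ε t : ℝ) : ℝ := Real.smoothTransition (t / ε - 1)

theorem contDiff_smoothStep (ε : ℝ) : ContDiff ℝ 2 (smoothStep ε) :=
  Real.smoothTransition.contDiff.comp ((contDiff_id.div_const ε).sub contDiff_const)

theorem smoothStep_nonneg (ε t : ℝ) : 0 ≤ smoothStep ε t := Real.smoothTransition.nonneg _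

theorem smoothStep_le_one (ε t : ℝ) : smoothStep ε t ≤ 1 := Real.smoothTransition.le_one _

theorem smoothStep_eq_zero {ε t : ℝ} (hε : 0 < ε) (ht : t ≤ ε) : smoothStep ε t = 0 :=
  Real.smoothTransition.zero_of_nonpos (by rw [sub_nonpos, div_le_one hε]; exact ht)

theorem smoothStep_eq_one {ε t : ℝ} (hε : 0 < ε) (ht : 2 * ε ≤ t) : smoothStep ε t = 1 :=
  Real.smoothTransition.one_of_one_le (by rw [le_sub_iff_add_le, le_div_iff₀ hε]; linarith)

theorem deriv_smoothStep_nonneg {ε : ℝ} (hε : 0 < ε) (t : ℝ) : 0 ≤ deriv (smoothStep ε) t := by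
  refine Monotone.deriv_nonneg fun a b hab => Real.smoothTransition.monotone ?_
  gcongr

theorem primitive_smoothStep_nonneg (ε : ℝ) {t : ℝ} (ht : 0 ≤ t) :
    0 ≤ primitive (smoothStep ε) t :=
  intervalIntegral.integral_nonneg ht fun s _ => smoothStep_nonneg ε s

theorem primitive_smoothStep_le (ε : ℝ) {t : ℝ} (ht : 0 ≤ t) :
    primitive (smoothStep ε) t ≤ t := by
  have := intervalIntegral.integral_mono_on ht
    ((contDiff_smoothStep ε).continuous.intervalIntegrable 0 t)
    (continuous_const.intervalIntegrable (μ := volume) (a := 0) (b := t))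
    fun s _ => smoothStep_le_one ε s
  simpa [primitive] using this

theorem sub_le_primitive_smoothStep {ε t : ℝ} (hε : 0 < ε) (ht : 0 ≤ t) :
    t - 2 * ε ≤ primitive (smoothStep ε) t := by
  rcases le_total t (2 * ε) with h | h
  · exact (by linarith : t - 2 * ε ≤ 0).trans (primitive_smoothStep_nonneg ε ht)
  have hc := (contDiff_smoothStep ε).continuous
  rw [primitive, ← intervalIntegral.integral_add_adjacent_intervals
    (hc.intervalIntegrable 0 (2 * ε)) (hc.intervalIntegrable (2 * ε) t)]
  have h1 : 0 ≤ ∫ s in (0 : ℝ)..2 * ε, smoothStep ε s :=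
    intervalIntegral.integral_nonneg (by linarith) fun s _ => smoothStep_nonneg ε s
  have h2 : ∫ s in (2 * ε)..t, smoothStep ε s = ∫ s in (2 * ε)..t, (1 : ℝ) :=
    intervalIntegral.integral_congr fun s hs => smoothStep_eq_one hε (by
      rw [Set.uIcc_of_le h] at hs; exact hs.1)
  rw [h2]
  simp only [intervalIntegral.integral_const, smul_eq_mul, mul_one]
  linarith

end Truncation

/-! ### Extension by zero of truncated functions. -/

section Localization

variable {E : Type*} [NormedAddCommGroup E] {U : Set E} {u : E → ℝ} {h : ℝ → ℝ} {ε : ℝ}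

/-- The superlevel set is compact, hence closed in the whole space, so a point outside `U` has a
neighbourhood on which `u < ε` wherever `u` is relevant. This replaces any boundary regularity. -/
theorem indicator_comp_eventuallyEq (hU : IsOpen U) (hc : IsCompact {x ∈ U | ε ≤ u x})
    (h0 : ∀ t ≤ ε, h t = 0) (x : E) :
    (x ∈ U ∧ U.indicator (h ∘ u) =ᶠ[𝓝 x] h ∘ u) ∨
      (x ∉ U ∧ U.indicator (h ∘ u) =ᶠ[𝓝 x] fun _ => 0) := by
  by_cases hx : x ∈ U
  · refine Or.inl ⟨hx, ?_⟩
    filter_upwards [hU.mem_nhds hx] with y hy using Set.indicator_of_mem hy _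
  · refine Or.inr ⟨hx, ?_⟩
    filter_upwards [hc.isClosed.isOpen_compl.mem_nhds (fun h' => hx h'.1)] with y hy
    by_cases hyU : y ∈ U
    · rw [Set.indicator_of_mem hyU]
      exact h0 _ (le_of_not_ge fun h' => hy ⟨hyU, h'⟩)
    · exact Set.indicator_of_notMem hyU _

theorem hasCompactSupport_indicator_comp (hc : IsCompact {x ∈ U | ε ≤ u x})
    (h0 : ∀ t ≤ ε, h t = 0) : HasCompactSupport (U.indicator (h ∘ u)) := by
  refine HasCompactSupport.intro hc fun x hx => ?_
  by_cases hxU : x ∈ U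
  · rw [Set.indicator_of_mem hxU]
    exact h0 _ (le_of_not_ge fun h' => hx ⟨hxU, h'⟩)
  · exact Set.indicator_of_notMem hxU _

variable [InnerProductSpace ℝ E]

theorem contDiff_indicator_comp (hU : IsOpen U) (hu : ContDiffOn ℝ 2 u U)
    (hc : IsCompact {x ∈ U | ε ≤ u x}) (hh : ContDiff ℝ 2 h) (h0 : ∀ t ≤ ε, h t = 0) :
    ContDiff ℝ 2 (U.indicator (h ∘ u)) := by
  rw [contDiff_iff_contDiffAt]
  intro x
  rcases indicator_comp_eventuallyEq hU hc h0 x with ⟨hx, he⟩ | ⟨hx, he⟩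
  · exact (hh.contDiffAt.comp x (hu.contDiffAt (hU.mem_nhds hx))).congr_of_eventuallyEq he
  · exact contDiffAt_const.congr_of_eventuallyEq he

variable [FiniteDimensional ℝ E]

theorem laplacian_indicator_comp (hU : IsOpen U) (hu : ContDiffOn ℝ 2 u U)
    (hc : IsCompact {x ∈ U | ε ≤ u x}) (hh : ContDiff ℝ 2 h) (h0 : ∀ t ≤ ε, h t = 0) :
    Laplacian.laplacian (U.indicator (h ∘ u)) = U.indicator fun x =>
      deriv h (u x) * Laplacian.laplacian u x + deriv (deriv h) (u x) * ‖gradient u x‖ ^ 2 := by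
  ext x
  rcases indicator_comp_eventuallyEq hU hc h0 x with ⟨hx, he⟩ | ⟨hx, he⟩
  · rw [(InnerProductSpace.laplacian_congr_nhds he).eq_of_nhds, Set.indicator_of_mem hx,
      laplacian_comp (hu.contDiffAt (hU.mem_nhds hx)) hh.contDiffAt]
  · rw [(InnerProductSpace.laplacian_congr_nhds he).eq_of_nhds, Set.indicator_of_notMem hx,
      InnerProductSpace.laplacian_eq_iteratedFDeriv_stdOrthonormalBasis]
    simp

end Localization

/-! ### The regularised logarithm as an approximate fundamental solution. -/

section LogKernel

theorem hasFDerivAt_norm_sub_sq {E : Type*} [NormedAddCommGroup E] [InnerProductSpace ℝ E]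
    (a x : E) : HasFDerivAt (fun y => ‖y - a‖ ^ 2) ((2 : ℝ) • innerSL ℝ (x - a)) x := by
  have := ((hasFDerivAt_id (𝕜 := ℝ) x).sub_const a).norm_sq
  simpa [two_smul] using this

theorem laplacian_norm_sub_sq {E : Type*} [NormedAddCommGroup E] [InnerProductSpace ℝ E]
    [FiniteDimensional ℝ E] (a x : E) :
    Laplacian.laplacian (fun y => ‖y - a‖ ^ 2) x = 2 * Module.finrank ℝ E := by
  have h : fderiv ℝ (fun y : E => ‖y - a‖ ^ 2) = fun x => (2 : ℝ) • innerSL ℝ (x - a) :=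
    funext fun x => (hasFDerivAt_norm_sub_sq a x).fderiv
  have h2 : HasFDerivAt (fun x : E => (2 : ℝ) • innerSL ℝ (x - a)) ((2 : ℝ) • innerSL ℝ) x :=
    ((innerSL ℝ).hasFDerivAt.comp x ((hasFDerivAt_id (𝕜 := ℝ) x).sub_const a)).const_smul (2 : ℝ)
  simp only [InnerProductSpace.laplacian_eq_iteratedFDeriv_stdOrthonormalBasis,
    iteratedFDeriv_two_apply, h, h2.fderiv]
  refine (Finset.sum_congr rfl fun i _ => (?_ : _ = (2 : ℝ))).trans (by simp [mul_comm])
  change (2 : ℝ) * inner ℝ (stdOrthonormalBasis ℝ E i) (stdOrthonormalBasis ℝ E i) = 2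
  simp

theorem norm_gradient_norm_sub_sq {E : Type*} [NormedAddCommGroup E] [InnerProductSpace ℝ E]
    [CompleteSpace E] (a x : E) :
    ‖gradient (fun y => ‖y - a‖ ^ 2) x‖ = 2 * ‖x - a‖ := by
  rw [gradient, (hasFDerivAt_norm_sub_sq a x).fderiv, LinearIsometryEquiv.norm_map, norm_smul,
    innerSL_apply_norm]
  simp

/-- The regularised logarithmic kernel `log (|y - a|² + δ²) / 2`. -/
noncomputable def logKernel (δ : ℝ) (a y : EuclideanSpace ℝ (Fin 2)) : ℝ :=
  Real.log (‖y - a‖ ^ 2 + δ ^ 2) / 2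

theorem contDiff_logKernel {δ : ℝ} (hδ : 0 < δ) (a : EuclideanSpace ℝ (Fin 2)) :
    ContDiff ℝ 2 (logKernel δ a) := by
  refine ContDiff.div_const (ContDiff.log ?_ fun y => by positivity) 2
  exact ((contDiff_id.sub contDiff_const).norm_sq ℝ).add contDiff_const

theorem laplacian_logKernel {δ : ℝ} (hδ : 0 < δ) (a y : EuclideanSpace ℝ (Fin 2)) :
    Laplacian.laplacian (logKernel δ a) y = 2 * δ ^ 2 / (‖y - a‖ ^ 2 + δ ^ 2) ^ 2 := by
  have hpos : 0 < ‖y - a‖ ^ 2 + δ ^ 2 := by positivity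
  have hq : ContDiff ℝ 2 (fun y : EuclideanSpace ℝ (Fin 2) => ‖y - a‖ ^ 2) :=
    (contDiff_id.sub contDiff_const).norm_sq ℝ
  have hd : ∀ t, 0 < t + δ ^ 2 →
      HasDerivAt (fun t => Real.log (t + δ ^ 2) / 2) ((t + δ ^ 2)⁻¹ / 2) t := fun t ht => by
    simpa using (((hasDerivAt_id t).add_const (δ ^ 2)).log ht.ne').div_const 2
  have hd1 := (hd _ hpos).deriv
  have hd2 : deriv (deriv fun t => Real.log (t + δ ^ 2) / 2) (‖y - a‖ ^ 2) =
      -((‖y - a‖ ^ 2 + δ ^ 2) ^ 2)⁻¹ / 2 := by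
    have he : (deriv fun t => Real.log (t + δ ^ 2) / 2) =ᶠ[𝓝 (‖y - a‖ ^ 2)]
        fun t => (t + δ ^ 2)⁻¹ / 2 := by
      filter_upwards [(continuous_id.add continuous_const).continuousAt.eventually
        (lt_mem_nhds hpos)] with t ht using (hd t ht).deriv
    rw [he.deriv_eq]
    have := ((((hasDerivAt_id (‖y - a‖ ^ 2)).add_const (δ ^ 2)).fun_inv hpos.ne').div_const 2).deriv
    simpa [neg_div] using this
  have := laplacian_comp (x := y) (f := fun y : EuclideanSpace ℝ (Fin 2) => ‖y - a‖ ^ 2)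
    (h := fun t => Real.log (t + δ ^ 2) / 2) hq.contDiffAt
    (((contDiffAt_id.add contDiffAt_const).log hpos.ne').div_const 2)
  rw [hd1, hd2, laplacian_norm_sub_sq, norm_gradient_norm_sub_sq] at this
  refine this.trans ?_
  simp only [finrank_euclideanSpace, Fintype.card_fin]
  field_simp
  push_cast
  ring

/-- Antiderivative of the radial density `2/(1 + r²)²` with the planar Jacobian `r`; it supplies
both integrability and the total mass `2π`. -/
theorem hasDerivAt_neg_inv_one_add_sq (r : ℝ) :
    HasDerivAt (fun r : ℝ => -(1 + r ^ 2)⁻¹) (r * (2 / (1 + r ^ 2) ^ 2)) r := by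
  have h : (1 + r ^ 2) ≠ 0 := by positivity
  refine ((((hasDerivAt_id r).fun_pow 2).const_add 1).fun_inv h).fun_neg.congr_deriv ?_
  simp only [id]
  field_simp
  norm_num [mul_comm]

theorem tendsto_neg_inv_one_add_sq : Tendsto (fun r : ℝ => -(1 + r ^ 2)⁻¹) atTop (𝓝 0) := by
  have h := (tendsto_atTop_add_const_left atTop (1 : ℝ)
    (tendsto_pow_atTop (α := ℝ) two_ne_zero)).inv_tendsto_atTop.neg
  simpa using h

theorem integrable_poisson :
    Integrable fun z : EuclideanSpace ℝ (Fin 2) => 2 / (1 + ‖z‖ ^ 2) ^ 2 := by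
  refine (integrable_fun_norm_addHaar volume (f := fun r : ℝ => 2 / (1 + r ^ 2) ^ 2)).2 ?_
  simp only [finrank_euclideanSpace, Fintype.card_fin, Nat.add_one_sub_one, pow_one, smul_eq_mul]
  exact integrableOn_Ioi_deriv_of_nonneg' (fun r _ => hasDerivAt_neg_inv_one_add_sq r)
    (fun r hr => mul_nonneg (Set.mem_Ioi.1 hr).le (by positivity)) tendsto_neg_inv_one_add_sq

theorem integral_poisson :
    ∫ z : EuclideanSpace ℝ (Fin 2), 2 / (1 + ‖z‖ ^ 2) ^ 2 = 2 * Real.pi := by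
  rw [integral_fun_norm_addHaar volume (fun r : ℝ => 2 / (1 + r ^ 2) ^ 2)]
  simp only [finrank_euclideanSpace, Fintype.card_fin, Nat.add_one_sub_one, pow_one, smul_eq_mul]
  rw [integral_Ioi_of_hasDerivAt_of_nonneg' (fun r _ => hasDerivAt_neg_inv_one_add_sq r)
    (fun r hr => mul_nonneg (Set.mem_Ioi.1 hr).le (by positivity)) tendsto_neg_inv_one_add_sq]
  simp [Measure.real, Real.pi_nonneg]

/-- Substitution `y = a + δ z`: in dimension two the Jacobian `δ²` exactly absorbs the scaling, so
the Laplacians form an approximate identity of mass `2π`. -/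
theorem integral_mul_laplacian_logKernel {δ : ℝ} (hδ : 0 < δ) (g : EuclideanSpace ℝ (Fin 2) → ℝ)
    (a : EuclideanSpace ℝ (Fin 2)) :
    ∫ y, Laplacian.laplacian (logKernel δ a) y * g y =
      ∫ z, 2 / (1 + ‖z‖ ^ 2) ^ 2 * g (a + δ • z) := by
  have h1 : ∀ z : EuclideanSpace ℝ (Fin 2), 2 / (1 + ‖z‖ ^ 2) ^ 2 * g (a + δ • z) =
      δ ^ 2 * (fun w => Laplacian.laplacian (logKernel δ a) (a + w) * g (a + w)) (δ • z) := by
    intro z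
    simp only [laplacian_logKernel hδ, add_sub_cancel_left, norm_smul, Real.norm_of_nonneg hδ.le]
    field_simp
    ring
  simp only [h1]
  rw [integral_const_mul, Measure.integral_comp_smul volume
      (fun w => Laplacian.laplacian (logKernel δ a) (a + w) * g (a + w)),
    integral_add_left_eq_self (fun y => Laplacian.laplacian (logKernel δ a) y * g y)]
  simp only [finrank_euclideanSpace, Fintype.card_fin, smul_eq_mul]
  rw [abs_of_pos (by positivity)]
  field_simp

theorem tendsto_integral_laplacian_logKernel {g : EuclideanSpace ℝ (Fin 2) → ℝ}
    (hg : Continuous g) (hgc : HasCompactSupport g) (a : EuclideanSpace ℝ (Fin 2)) :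
    Tendsto (fun δ => ∫ y, Laplacian.laplacian (logKernel δ a) y * g y) (𝓝[>] 0)
      (𝓝 (2 * Real.pi * g a)) := by
  obtain ⟨C, hC⟩ := hgc.exists_bound_of_continuous hg
  have hcont : Continuous fun z : EuclideanSpace ℝ (Fin 2) => 2 / (1 + ‖z‖ ^ 2) ^ 2 :=
    continuous_const.div (by fun_prop) fun z => by positivity
  have key : Tendsto (fun δ : ℝ => ∫ z, 2 / (1 + ‖z‖ ^ 2) ^ 2 * g (a + δ • z)) (𝓝[>] 0)
      (𝓝 (∫ z : EuclideanSpace ℝ (Fin 2), 2 / (1 + ‖z‖ ^ 2) ^ 2 * g a)) := by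
    refine tendsto_integral_filter_of_dominated_convergence
      (fun z => 2 / (1 + ‖z‖ ^ 2) ^ 2 * C) ?_ ?_ (integrable_poisson.mul_const C) ?_
    · exact Eventually.of_forall fun δ => (hcont.mul (by fun_prop)).aestronglyMeasurable
    · refine Eventually.of_forall fun δ => Eventually.of_forall fun z => ?_
      rw [norm_mul, Real.norm_of_nonneg (by positivity)]
      gcongr
      exact hC _
    · refine Eventually.of_forall fun z => Tendsto.mono_left ?_ nhdsWithin_le_nhds
      have : Continuous fun δ : ℝ => 2 / (1 + ‖z‖ ^ 2) ^ 2 * g (a + δ • z) := by fun_prop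
      simpa using this.tendsto 0
  rw [integral_mul_const, integral_poisson] at key
  refine key.congr' ?_
  filter_upwards [self_mem_nhdsWithin] with δ hδ
  rw [integral_mul_laplacian_logKernel hδ]

end LogKernel

/-! ### Newtonian potential bound and entropy estimate. -/

section PointwiseBound

/-- The regularised Newtonian kernel `log (3 / sqrt (|y - a|² + δ²))`, nonnegative on discs of
radius `2`. -/
noncomputable def newtonKernel (δ : ℝ) (a y : EuclideanSpace ℝ (Fin 2)) : ℝ :=
  Real.log 3 - logKernel δ a y

theorem continuous_newtonKernel {δ : ℝ} (hδ : 0 < δ) (a : EuclideanSpace ℝ (Fin 2)) :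
    Continuous (newtonKernel δ a) :=
  continuous_const.sub (contDiff_logKernel hδ a).continuous

theorem dist_lt_two_of_mem_unitDisc {a y : EuclideanSpace ℝ (Fin 2)} (ha : a ∈ unitDisc)
    (hy : y ∈ unitDisc) : ‖y - a‖ < 2 := by
  have h1 : ‖a‖ < 1 := by simpa [unitDisc] using ha
  have h2 : ‖y‖ < 1 := by simpa [unitDisc] using hy
  linarith [norm_sub_le y a]

theorem newtonKernel_nonneg {δ : ℝ} (hδ : 0 < δ) (hδ1 : δ ≤ 1) {a y : EuclideanSpace ℝ (Fin 2)}
    (ha : a ∈ unitDisc) (hy : y ∈ unitDisc) : 0 ≤ newtonKernel δ a y := by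
  have h := dist_lt_two_of_mem_unitDisc ha hy
  have h1 : Real.log (‖y - a‖ ^ 2 + δ ^ 2) ≤ Real.log (3 ^ 2) :=
    Real.log_le_log (by positivity) (by nlinarith [norm_nonneg (y - a)])
  rw [Real.log_pow] at h1
  push_cast at h1
  rw [newtonKernel, logKernel]
  linarith

theorem newtonKernel_le {δ : ℝ} (hδ : 0 < δ) (a y : EuclideanSpace ℝ (Fin 2)) :
    newtonKernel δ a y ≤ Real.log 3 - Real.log δ := by
  have h1 : Real.log (δ ^ 2) ≤ Real.log (‖y - a‖ ^ 2 + δ ^ 2) :=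
    Real.log_le_log (by positivity) (by nlinarith [norm_nonneg (y - a)])
  rw [Real.log_pow] at h1
  push_cast at h1
  rw [newtonKernel, logKernel]
  linarith

theorem exp_mul_newtonKernel_le {δ s : ℝ} (hs : 0 < s) {a y : EuclideanSpace ℝ (Fin 2)}
    (h : y ≠ a) : Real.exp (s * newtonKernel δ a y) ≤ 3 ^ s * ‖y - a‖ ^ (-s) := by
  have hpos : 0 < ‖y - a‖ := norm_pos_iff.2 (sub_ne_zero.2 h)
  have h1 : Real.log (‖y - a‖ ^ 2) ≤ Real.log (‖y - a‖ ^ 2 + δ ^ 2) :=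
    Real.log_le_log (by positivity) (by nlinarith [sq_nonneg δ])
  rw [Real.log_pow] at h1
  push_cast at h1
  rw [Real.rpow_def_of_pos (by norm_num : (0 : ℝ) < 3), Real.rpow_def_of_pos hpos, ← Real.exp_add]
  refine Real.exp_le_exp.2 ?_
  rw [newtonKernel, logKernel]
  nlinarith

variable {U : Set (EuclideanSpace ℝ (Fin 2))} {u f : EuclideanSpace ℝ (Fin 2) → ℝ}

theorem integrableOn_mul_newtonKernel {δ : ℝ} (hδ : 0 < δ) (hδ1 : δ ≤ 1) (hU : MeasurableSet U)
    (hUB : U ⊆ unitDisc) (hf : IntegrableOn f U) {a : EuclideanSpace ℝ (Fin 2)}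
    (ha : a ∈ unitDisc) : IntegrableOn (fun y => f y * newtonKernel δ a y) U := by
  refine Integrable.mul_bdd (c := Real.log 3 - Real.log δ) hf
    (continuous_newtonKernel hδ a).aestronglyMeasurable ?_
  filter_upwards [ae_restrict_mem hU] with y hy
  rw [Real.norm_of_nonneg (newtonKernel_nonneg hδ hδ1 ha (hUB hy))]
  exact newtonKernel_le hδ a y

/-- A nonnegative function vanishing on the boundary of `U` is bounded by the Newtonian potential
of its negative Laplacian. -/
theorem two_pi_mul_le_of_newtonian_potential_le (hU : IsOpen U) (hUB : U ⊆ unitDisc)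
    (hu : ContDiffOn ℝ 2 u U) (hu0 : ∀ x ∈ U, 0 ≤ u x)
    (hc : ∀ ε > 0, IsCompact {x ∈ U | ε ≤ u x}) (hf : IntegrableOn f U)
    (hf0 : ∀ x ∈ U, 0 ≤ f x) (hfu : ∀ x ∈ U, -(Laplacian.laplacian u x) = f x)
    {a : EuclideanSpace ℝ (Fin 2)} (ha : a ∈ U) {T : ℝ}
    (hT : ∀ δ : ℝ, 0 < δ → δ ≤ 1 → ∫ y in U, f y * newtonKernel δ a y ≤ T) :
    2 * Real.pi * u a ≤ T := by
  have main : ∀ ε > 0, 2 * Real.pi * primitive (smoothStep ε) (u a) ≤ T := by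
    intro ε hε
    have hs := contDiff_smoothStep ε
    have hh := contDiff_primitive hs
    have h0 : ∀ t ≤ ε, primitive (smoothStep ε) t = 0 := fun t ht =>
      primitive_eq_zero hε.le (fun s hs => smoothStep_eq_zero hε hs) ht
    have hW := contDiff_indicator_comp hU hu (hc ε hε) hh h0
    have hWc := hasCompactSupport_indicator_comp (hc ε hε) h0
    have hΔ := laplacian_indicator_comp hU hu (hc ε hε) hh h0
    set W := U.indicator (primitive (smoothStep ε) ∘ u) with hWdef
    have hlim := tendsto_integral_laplacian_logKernel hW.continuous hWc a
    rw [hWdef, Set.indicator_of_mem ha, ← hWdef] at hlim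
    refine le_of_tendsto hlim ?_
    filter_upwards [Ioc_mem_nhdsGT (zero_lt_one' ℝ)] with δ hδ
    refine le_trans ?_ (hT δ hδ.1 hδ.2)
    have hcΔ := continuous_laplacian hW
    have hsΔ := hasCompactSupport_laplacian hWc
    have hLi : Integrable fun y => logKernel δ a y * Laplacian.laplacian W y :=
      ((contDiff_logKernel hδ.1 a).continuous.mul hcΔ).integrable_of_hasCompactSupport hsΔ.mul_left
    have h3i : Integrable fun y => Real.log 3 * Laplacian.laplacian W y :=
      (hcΔ.integrable_of_hasCompactSupport hsΔ).const_mul _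
    -- The constant `log 3`, which makes the kernel nonnegative on the disc, costs nothing because
    -- `ΔW` has integral zero.
    have e1 : ∫ y, Laplacian.laplacian (logKernel δ a) y * W y =
        ∫ y, -(newtonKernel δ a y * Laplacian.laplacian W y) := by
      rw [← integral_mul_laplacian hW hWc (contDiff_logKernel hδ.1 a)]
      have : ∀ y, -(newtonKernel δ a y * Laplacian.laplacian W y) =
          logKernel δ a y * Laplacian.laplacian W y - Real.log 3 * Laplacian.laplacian W y := by
        intro y
        rw [newtonKernel]
        ring
      simp only [this]
      rw [integral_sub hLi h3i, integral_const_mul, integral_laplacian_eq_zero hW hWc]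
      simp
    have hki : Integrable fun y => -(newtonKernel δ a y * Laplacian.laplacian W y) :=
      (((continuous_newtonKernel hδ.1 a).mul hcΔ).integrable_of_hasCompactSupport
        hsΔ.mul_left).neg
    rw [e1, ← integral_indicator hU.measurableSet]
    refine integral_mono hki ((integrable_indicator_iff hU.measurableSet).2
      (integrableOn_mul_newtonKernel hδ.1 hδ.2 hU.measurableSet hUB hf (hUB ha))) fun y => ?_
    simp only [hΔ]
    by_cases hy : y ∈ U
    · rw [Set.indicator_of_mem hy, Set.indicator_of_mem hy, deriv_primitive hs.continuous]
      have k0 := newtonKernel_nonneg hδ.1 hδ.2 (hUB ha) (hUB hy)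
      -- The truncation is convex with slope at most `1`, so `-ΔW ≤ f`: the gradient term has the
      -- favourable sign.
      have b1 : 0 ≤ deriv (smoothStep ε) (u y) * ‖gradient u y‖ ^ 2 :=
        mul_nonneg (deriv_smoothStep_nonneg hε _) (sq_nonneg _)
      have b2 : smoothStep ε (u y) * f y ≤ f y :=
        mul_le_of_le_one_left (hf0 y hy) (smoothStep_le_one _ _)
      rw [← hfu y hy] at b2 ⊢
      nlinarith
    · simp [Set.indicator_of_notMem hy]
  refine le_of_forall_pos_le_add fun η hη => ?_
  -- Truncation loses at most `2ε` in `u a`, that is `4πε = η` after multiplication by `2π`.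
  have hε : 0 < η / (4 * Real.pi) := by positivity
  have h1 := main _ hε
  have h2 := sub_le_primitive_smoothStep hε (hu0 a ha)
  have h3 : 2 * Real.pi * (u a - 2 * (η / (4 * Real.pi))) = 2 * Real.pi * u a - η := by
    field_simp
    ring
  have := mul_le_mul_of_nonneg_left h2 (by positivity : 0 ≤ 2 * Real.pi)
  linarith

/-- Young's inequality for the Legendre pair `s log s - s` and `exp t`, with the term `-s` dropped.
-/
theorem mul_le_mul_log_add_exp {s : ℝ} (hs : 0 ≤ s) (t : ℝ) :
    s * t ≤ s * Real.log s + Real.exp t := by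
  rcases hs.eq_or_lt with rfl | hs
  · simp [(Real.exp_pos t).le]
  · have h := Real.add_one_le_exp (t - Real.log s)
    rw [Real.exp_sub, Real.exp_log hs, le_div_iff₀ hs] at h
    nlinarith

/-- The constant in the entropy estimate for the Newtonian potential. -/
noncomputable def entropyConst (s : ℝ) : ℝ :=
  ∫ z in Metric.ball (0 : EuclideanSpace ℝ (Fin 2)) 2, 3 ^ s * ‖z‖ ^ (-s)

theorem integrableOn_entropyConst {s : ℝ} (hs : s < 2) :
    IntegrableOn (fun z : EuclideanSpace ℝ (Fin 2) => 3 ^ s * ‖z‖ ^ (-s)) (Metric.ball 0 2) := by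
  have h : LocallyIntegrable (fun z : EuclideanSpace ℝ (Fin 2) => 3 ^ s * ‖z‖ ^ (-s)) := by
    refine locallyIntegrable_of_norm_le_rpow (C := 3 ^ s) (α := s) (by simp) (by simpa using hs)
      (Eventually.of_forall fun z => ?_)
      ((measurable_norm.pow_const (-s)).const_mul (3 ^ s)).aestronglyMeasurable
    rw [Real.norm_of_nonneg (by positivity)]
  exact (h.integrableOn_isCompact (isCompact_closedBall 0 2)).mono_set Metric.ball_subset_closedBall

/-- Comparison with `(3/|y - a|)^s` on the disc of radius `2` about `a`, which contains `U`;
translation makes the bound independent of both `δ` and `a`. -/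
theorem setIntegral_exp_newtonKernel_le {δ s : ℝ} (hδ : 0 < δ) (hs : 0 < s)
    (hs2 : s < 2) (hUB : U ⊆ unitDisc) {a : EuclideanSpace ℝ (Fin 2)} (ha : a ∈ unitDisc) :
    IntegrableOn (fun y => Real.exp (s * newtonKernel δ a y)) U ∧
      ∫ y in U, Real.exp (s * newtonKernel δ a y) ≤ entropyConst s := by
  have hsub : U ⊆ Metric.ball a 2 := fun y hy => by
    rw [mem_ball_iff_norm]
    exact dist_lt_two_of_mem_unitDisc ha (hUB hy)
  have hmp : MeasurePreserving (fun y : EuclideanSpace ℝ (Fin 2) => y - a) volume volume :=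
    measurePreserving_sub_right volume a
  have hemb : MeasurableEmbedding (fun y : EuclideanSpace ℝ (Fin 2) => y - a) :=
    (Homeomorph.subRight a).measurableEmbedding
  have hpre : (fun y => y - a) ⁻¹' (Metric.ball (0 : EuclideanSpace ℝ (Fin 2)) 2) =
      Metric.ball a 2 := by
    ext y
    simp [dist_eq_norm]
  have hi : IntegrableOn (fun y => 3 ^ s * ‖y - a‖ ^ (-s)) (Metric.ball a 2) := by
    rw [← hpre]
    exact (hmp.integrableOn_comp_preimage hemb).2 (integrableOn_entropyConst hs2)
  have he : ∫ y in Metric.ball a 2, 3 ^ s * ‖y - a‖ ^ (-s) = entropyConst s := by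
    rw [← hpre]
    exact hmp.setIntegral_preimage_emb hemb (fun z => 3 ^ s * ‖z‖ ^ (-s)) _
  have hae : ∀ᵐ y ∂(volume : Measure (EuclideanSpace ℝ (Fin 2))),
      Real.exp (s * newtonKernel δ a y) ≤ 3 ^ s * ‖y - a‖ ^ (-s) := by
    filter_upwards [compl_mem_ae_iff.2 (measure_singleton a)] with y hy
    exact exp_mul_newtonKernel_le hs hy
  have hexp : IntegrableOn (fun y => Real.exp (s * newtonKernel δ a y)) U := by
    refine (hi.mono_set hsub).mono'
      (continuous_const.mul (continuous_newtonKernel hδ a)).rexp.aestronglyMeasurable ?_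
    filter_upwards [ae_restrict_of_ae hae] with y hy
    rwa [Real.norm_of_nonneg (Real.exp_pos _).le]
  refine ⟨hexp, (integral_mono_ae hexp (hi.mono_set hsub) (ae_restrict_of_ae hae)).trans ?_⟩
  rw [← he]
  exact setIntegral_mono_set hi (Eventually.of_forall fun y => by positivity)
    (Eventually.of_forall hsub)

/-- Young's inequality is applied to the normalised density `f / M` and the exponent `s *
newtonKernel δ a y`, then integrated. -/
theorem setIntegral_mul_newtonKernel_le {δ s : ℝ} (hδ : 0 < δ) (hδ1 : δ ≤ 1) (hs : 0 < s)
    (hs2 : s < 2) (hU : MeasurableSet U) (hUB : U ⊆ unitDisc) (hf : IntegrableOn f U)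
    (hf0 : ∀ x ∈ U, 0 ≤ f x) (hfl : IntegrableOn (fun y => f y * Real.log (f y)) U)
    (hM : 0 < ∫ y in U, f y) {a : EuclideanSpace ℝ (Fin 2)} (ha : a ∈ unitDisc) :
    s * ∫ y in U, f y * newtonKernel δ a y ≤ (∫ y in U, f y * Real.log (f y)) -
      (∫ y in U, f y) * Real.log (∫ y in U, f y) + (∫ y in U, f y) * entropyConst s := by
  set M := ∫ y in U, f y with hMdef
  obtain ⟨hexp, hle⟩ := setIntegral_exp_newtonKernel_le (U := U) hδ hs hs2 hUB ha
  have hk := integrableOn_mul_newtonKernel hδ hδ1 hU hUB hf ha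
  have key : ∀ y ∈ U, s * (f y * newtonKernel δ a y) ≤ f y * Real.log (f y) - f y * Real.log M +
      M * Real.exp (s * newtonKernel δ a y) := by
    intro y hy
    have h := mul_le_mul_of_nonneg_left (mul_le_mul_log_add_exp
      (div_nonneg (hf0 y hy) hM.le) (s * newtonKernel δ a y)) hM.le
    rcases (hf0 y hy).eq_or_lt with h0 | h0
    · simp only [← h0, zero_mul, mul_zero, sub_zero, zero_add]
      positivity
    rw [Real.log_div h0.ne' hM.ne'] at h
    have e1 : M * (f y / M * (s * newtonKernel δ a y)) = s * (f y * newtonKernel δ a y) := by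
      field_simp
    have e2 : M * (f y / M * (Real.log (f y) - Real.log M) + Real.exp (s * newtonKernel δ a y)) =
      f y * Real.log (f y) - f y * Real.log M + M * Real.exp (s * newtonKernel δ a y) := by
      field_simp
    rwa [e1, e2] at h
  have hfm : IntegrableOn (fun y => f y * Real.log (f y) - f y * Real.log M) U :=
    hfl.sub (hf.mul_const _)
  have hint := setIntegral_mono_on (hk.const_mul s) (hfm.add (hexp.const_mul M)) hU key
  rw [integral_const_mul, integral_add' hfm (hexp.const_mul M),
    integral_sub hfl (hf.mul_const _), integral_mul_const, integral_const_mul, ← hMdef] at hint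
  exact hint.trans (by gcongr)

end PointwiseBound

/-! ### Lower bound on a region where the solution is positive. -/

section EnergyLowerBound

variable {U : Set (EuclideanSpace ℝ (Fin 2))} {u g : EuclideanSpace ℝ (Fin 2) → ℝ} {α p : ℝ}

theorem integrableOn_of_continuousOn_of_bounded (hU : IsOpen U) (hUB : U ⊆ unitDisc)
    (hg : ContinuousOn g U) {C : ℝ} (hC : ∀ x ∈ U, |g x| ≤ C) : IntegrableOn g U := by
  refine IntegrableOn.of_bound ((measure_mono hUB).trans_lt measure_ball_lt_top)
    (hg.aestronglyMeasurable hU.measurableSet) C ?_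
  filter_upwards [ae_restrict_mem hU.measurableSet] with x hx using hC x hx

/-- The origin is exempted because the weight `|x|^α` vanishes there when `α > 0`; a point is
negligible. -/
theorem setIntegral_pos_of_pos_off_zero (hU : IsOpen U) (hne : U.Nonempty)
    (hg : IntegrableOn g U) (h0 : ∀ x ∈ U, 0 ≤ g x) (hpos : ∀ x ∈ U, x ≠ 0 → 0 < g x) :
    0 < ∫ x in U, g x := by
  rw [setIntegral_pos_iff_support_of_nonneg_ae
    (by filter_upwards [ae_restrict_mem hU.measurableSet] with x hx using h0 x hx) hg]
  calc 0 < volume U := hU.measure_pos _ hne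
    _ = volume (U \ {0}) := (measure_sdiff_null (measure_singleton 0)).symm
    _ ≤ volume (Function.support g ∩ U) :=
        measure_mono fun x hx => ⟨(hpos x hx.1 hx.2).ne', hx.1⟩

/-- Eliminates `M`. The hypothesis contains `-(p + 1) log M`, and `log x ≤ x - 1` at `x = 4πsJ / ((p
+ 1) M²)`, multiplied by `(p + 1)/2`, produces the same term, so it cancels. -/
theorem log_energy_bound {M J C s : ℝ} (hp : 1 < p) (hM : 0 < M) (hJ : 0 < J) (hs : 0 < s)
    (h : 2 * Real.pi * s * J ≤ M ^ 2 * (p * Real.log (J / M) - Real.log M + C)) :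
    (p + 1) / 2 * (Real.log (4 * Real.pi * s) + 1) ≤
      (p - 1) / 2 * Real.log ((p + 1) * J) + Real.log (p + 1) + C := by
  have hp1 : 0 < p + 1 := by linarith
  have hs4 : 0 < 4 * Real.pi * s := by positivity
  have h1 := Real.log_le_sub_one_of_pos
    (show 0 < 4 * Real.pi * s * J / ((p + 1) * M ^ 2) by positivity)
  rw [Real.log_div (by positivity) (by positivity), Real.log_mul hs4.ne' hJ.ne',
    Real.log_mul hp1.ne' (by positivity), Real.log_pow] at h1
  push_cast at h1
  rw [Real.log_div hJ.ne' hM.ne'] at h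
  rw [Real.log_mul hp1.ne' hJ.ne']
  have h2 : 2 * Real.pi * s * J / M ^ 2 ≤
      p * (Real.log J - Real.log M) - Real.log M + C := by
    rw [div_le_iff₀ (by positivity)]
    linarith
  have h3 : (p + 1) / 2 * (4 * Real.pi * s * J / ((p + 1) * M ^ 2)) =
      2 * Real.pi * s * J / M ^ 2 := by
    field_simp
    ring
  have h4 := mul_le_mul_of_nonneg_left h1 (by linarith : 0 ≤ (p + 1) / 2)
  linarith

/-- Lower bound for the energy of a positive solution vanishing on the boundary of its domain. -/
theorem log_setIntegral_lower_bound (hα : 0 ≤ α) (hp : 1 < p) {s : ℝ} (hs : 0 < s) (hs2 : s < 2)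
    (hU : IsOpen U) (hne : U.Nonempty) (hUB : U ⊆ unitDisc) (hu : ContDiffOn ℝ 2 u U)
    (hu0 : ∀ x ∈ U, 0 < u x) (hc : ∀ ε > 0, IsCompact {x ∈ U | ε ≤ u x}) {b : ℝ}
    (hb : ∀ x ∈ U, u x ≤ b)
    (heq : ∀ x ∈ U, -(Laplacian.laplacian u x) = ‖x‖ ^ α * u x ^ p) :
    0 < ∫ x in U, ‖x‖ ^ α * u x ^ (p + 1) ∧
    (p + 1) / 2 * (Real.log (4 * Real.pi * s) + 1) ≤
      (p - 1) / 2 * Real.log ((p + 1) * ∫ x in U, ‖x‖ ^ α * u x ^ (p + 1)) + Real.log (p + 1) +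
        entropyConst s := by
  set f : EuclideanSpace ℝ (Fin 2) → ℝ := fun x => ‖x‖ ^ α * u x ^ p with hf
  have hb0 : 0 ≤ b := by
    obtain ⟨x, hx⟩ := hne
    exact (hu0 x hx).le.trans (hb x hx)
  have hnorm : ∀ x ∈ U, ‖x‖ ^ α ≤ 1 := fun x hx =>
    Real.rpow_le_one (norm_nonneg x) (mem_ball_zero_iff.1 (hUB hx)).le hα
  have hcα : Continuous fun x : EuclideanSpace ℝ (Fin 2) => ‖x‖ ^ α :=
    continuous_norm.rpow_const fun _ => Or.inr hα
  have hfc : ContinuousOn f U :=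
    hcα.continuousOn.mul (hu.continuousOn.rpow_const fun _ _ => Or.inr (by linarith))
  have hf0 : ∀ x ∈ U, 0 ≤ f x := fun x hx => by
    have := hu0 x hx
    positivity
  have hfup : ∀ x ∈ U, f x ≤ u x ^ p := fun x hx =>
    mul_le_of_le_one_left (Real.rpow_nonneg (hu0 x hx).le p) (hnorm x hx)
  have hfb : ∀ x ∈ U, f x ≤ b ^ p := fun x hx => (hfup x hx).trans
    (Real.rpow_le_rpow (hu0 x hx).le (hb x hx) (by linarith))
  have hfpos : ∀ x ∈ U, x ≠ 0 → 0 < f x := fun x hx h0 =>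
    mul_pos (Real.rpow_pos_of_pos (norm_pos_iff.2 h0) _) (Real.rpow_pos_of_pos (hu0 x hx) _)
  have hfi : IntegrableOn f U := integrableOn_of_continuousOn_of_bounded hU hUB hfc
    fun x hx => by
      rw [abs_of_nonneg (hf0 x hx)]
      exact hfb x hx
  have hfl : IntegrableOn (fun y => f y * Real.log (f y)) U := by
    obtain ⟨C, hC⟩ := (isCompact_Icc (a := 0) (b := b ^ p)).exists_bound_of_continuousOn
      Real.continuous_mul_log.continuousOn
    exact integrableOn_of_continuousOn_of_bounded hU hUB
      (Real.continuous_mul_log.comp_continuousOn hfc) fun x hx => hC _ ⟨hf0 x hx, hfb x hx⟩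
  have hfui : IntegrableOn (fun y => f y * u y) U :=
    integrableOn_of_continuousOn_of_bounded (C := b ^ p * b) hU hUB (hfc.mul hu.continuousOn)
      fun x hx => by
        rw [abs_of_nonneg (mul_nonneg (hf0 x hx) (hu0 x hx).le)]
        exact mul_le_mul (hfb x hx) (hb x hx) (hu0 x hx).le (by positivity)
  have hJeq : ∫ x in U, ‖x‖ ^ α * u x ^ (p + 1) = ∫ x in U, f x * u x :=
    setIntegral_congr_fun hU.measurableSet fun x hx => by
      simp only [hf]
      rw [Real.rpow_add_one (hu0 x hx).ne', mul_assoc]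
  have hM := setIntegral_pos_of_pos_off_zero hU hne hfi hf0 hfpos
  have hJ := setIntegral_pos_of_pos_off_zero hU hne hfui
    (fun x hx => mul_nonneg (hf0 x hx) (hu0 x hx).le)
    (fun x hx h0 => mul_pos (hfpos x hx h0) (hu0 x hx))
  rw [hJeq]
  set M := ∫ x in U, f x with hMdef
  set J := ∫ x in U, f x * u x with hJdef
  have hA : 0 < J / M := div_pos hJ hM
  refine ⟨hJ, log_energy_bound hp hM hJ hs ?_⟩
  have hent : ∫ y in U, f y * Real.log (f y) ≤ p * M * Real.log (J / M) := by
    -- Jensen's inequality through the tangent of `log` at `J / M`, the mean of `u` under the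
    -- density `f / M`; the linear correction integrates to zero.
    have key : ∀ y ∈ U, f y * Real.log (f y) ≤
        p * Real.log (J / M) * f y + (p * (M / J) * (f y * u y) - p * f y) := by
      intro y hy
      rcases (hf0 y hy).eq_or_lt with h0 | h0
      · simp [← h0]
      have h1 : Real.log (f y) ≤ p * Real.log (u y) := by
        rw [← Real.log_rpow (hu0 y hy)]
        exact Real.log_le_log h0 (hfup y hy)
      have h2 := Real.log_le_sub_one_of_pos (div_pos (hu0 y hy) hA)
      rw [Real.log_div (hu0 y hy).ne' hA.ne', div_div_eq_mul_div, mul_div_assoc] at h2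
      have h3 := mul_le_mul_of_nonneg_left h2 (by linarith : 0 ≤ p)
      have h4 : Real.log (f y) ≤ p * Real.log (J / M) + (p * (u y * (M / J)) - p) := by linarith
      have := mul_le_mul_of_nonneg_left h4 h0.le
      linarith
    have i1 : IntegrableOn (fun y => p * (M / J) * (f y * u y) - p * f y) U :=
      (hfui.const_mul _).sub (hfi.const_mul _)
    have h := setIntegral_mono_on hfl ((hfi.const_mul (p * Real.log (J / M))).add i1)
      hU.measurableSet key
    rw [integral_add' (hfi.const_mul _) i1, integral_sub (hfui.const_mul _) (hfi.const_mul _),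
      integral_const_mul, integral_const_mul, integral_const_mul, ← hMdef, ← hJdef] at h
    have e : p * (M / J) * J = p * M := by field_simp
    rw [e] at h
    linarith
  set D := M * (p * Real.log (J / M) - Real.log M + entropyConst s) with hD
  have hpt : ∀ a ∈ U, 2 * Real.pi * s * u a ≤ D := by
    intro a ha
    have := two_pi_mul_le_of_newtonian_potential_le hU hUB hu (fun x hx => (hu0 x hx).le) hc hfi
      hf0 heq ha (T := D / s) fun δ hδ hδ1 => by
        rw [le_div_iff₀' hs]
        have := setIntegral_mul_newtonKernel_le hδ hδ1 hs hs2 hU.measurableSet hUB hfi hf0 hfl hM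
          (hUB ha)
        rw [← hMdef] at this
        linarith
    rw [le_div_iff₀ hs] at this
    linarith
  -- Integrating the pointwise bound against `f` turns `u` into `J` and the constant `D` into `M *
  -- D`.
  have hint := setIntegral_mono_on (hfui.const_mul (2 * Real.pi * s)) (hfi.mul_const D)
    hU.measurableSet fun y hy => by
      have := mul_le_mul_of_nonneg_left (hpt y hy) (hf0 y hy)
      linarith
  rw [integral_const_mul, integral_mul_const, ← hMdef, ← hJdef, hD] at hint
  linarith

end EnergyLowerBound

/-! ### Dirichlet energy by testing with truncations. -/

section EnergyInequality

variable {U : Set (EuclideanSpace ℝ (Fin 2))} {u f : EuclideanSpace ℝ (Fin 2) → ℝ}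

theorem continuousOn_gradient {E : Type*} [NormedAddCommGroup E] [InnerProductSpace ℝ E]
    [CompleteSpace E] {U : Set E} {u : E → ℝ} (hU : IsOpen U) (hu : ContDiffOn ℝ 2 u U) :
    ContinuousOn (gradient u) U :=
  (InnerProductSpace.toDual ℝ E).symm.continuous.comp_continuousOn
    (hu.continuousOn_fderiv_of_isOpen hU (by norm_num))

/-- A positive function with `-Δ u = f ≥ 0` vanishing on the boundary of `U` has finite Dirichlet
energy, at least `∫ f u`. -/
theorem integrableOn_gradient_sq_of_pos (hU : IsOpen U) (hu : ContDiffOn ℝ 2 u U)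
    (hu0 : ∀ x ∈ U, 0 < u x) (hc : ∀ ε > 0, IsCompact {x ∈ U | ε ≤ u x}) (hf : IntegrableOn f U)
    (hfui : IntegrableOn (fun x => f x * u x) U) (hf0 : ∀ x ∈ U, 0 ≤ f x)
    (hfu : ∀ x ∈ U, -(Laplacian.laplacian u x) = f x) :
    IntegrableOn (fun x => ‖gradient u x‖ ^ 2) U ∧
      ∫ x in U, f x * u x ≤ ∫ x in U, ‖gradient u x‖ ^ 2 := by
  have hgc : ContinuousOn (fun x => ‖gradient u x‖ ^ 2) U := (continuousOn_gradient hU hu).norm.pow 2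
  have key : ∀ ε > 0, IntegrableOn (fun x => f x * primitive (smoothStep ε) (u x)) U ∧
      IntegrableOn (fun x => smoothStep ε (u x) * ‖gradient u x‖ ^ 2) U ∧
      ∫ x in U, smoothStep ε (u x) * ‖gradient u x‖ ^ 2 =
        ∫ x in U, f x * primitive (smoothStep ε) (u x) := by
    intro ε hε
    have hs := contDiff_smoothStep ε
    have hh := contDiff_primitive hs
    have h0 : ∀ t ≤ ε, primitive (smoothStep ε) t = 0 := fun t ht =>
      primitive_eq_zero hε.le (fun s hs => smoothStep_eq_zero hε hs) ht
    have hh2 := contDiff_primitive hh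
    have h02 : ∀ t ≤ ε, primitive (primitive (smoothStep ε)) t = 0 := fun t ht =>
      primitive_eq_zero hε.le h0 ht
    -- With the second primitive of `smoothStep ε`, the Laplacian of `W` is the divergence of `h(u)
    -- ∇u`, where `h` is the first primitive; its zero integral is the equation tested with `h(u)`.
    have hW := contDiff_indicator_comp hU hu (hc ε hε) hh2 h02
    have hWc := hasCompactSupport_indicator_comp (hc ε hε) h02
    have hΔ := laplacian_indicator_comp hU hu (hc ε hε) hh2 h02
    have hint := integral_laplacian_eq_zero hW hWc
    have hi := (continuous_laplacian hW).integrable_of_hasCompactSupport (μ := volume)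
      (hasCompactSupport_laplacian hWc)
    rw [hΔ, deriv_primitive hh.continuous, deriv_primitive hs.continuous] at hint hi
    rw [integral_indicator hU.measurableSet] at hint
    replace hi := (integrable_indicator_iff hU.measurableSet).1 hi
    have i1 : IntegrableOn (fun x => f x * primitive (smoothStep ε) (u x)) U := by
      refine Integrable.mono' hfui (hf.aestronglyMeasurable.mul
        ((hh.continuous.comp_continuousOn hu.continuousOn).aestronglyMeasurable
          hU.measurableSet)) ?_
      filter_upwards [ae_restrict_mem hU.measurableSet] with x hx
      rw [Real.norm_of_nonneg
        (mul_nonneg (hf0 x hx) (primitive_smoothStep_nonneg ε (hu0 x hx).le))]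
      exact mul_le_mul_of_nonneg_left (primitive_smoothStep_le ε (hu0 x hx).le) (hf0 x hx)
    have hcongr : Set.EqOn (fun x => smoothStep ε (u x) * ‖gradient u x‖ ^ 2)
        ((fun x => primitive (smoothStep ε) (u x) * Laplacian.laplacian u x +
          smoothStep ε (u x) * ‖gradient u x‖ ^ 2) +
          fun x => f x * primitive (smoothStep ε) (u x)) U := fun x hx => by
      simp only [Pi.add_apply, ← hfu x hx]
      ring
    refine ⟨i1, (integrableOn_congr_fun hcongr hU.measurableSet).2 (hi.add i1), ?_⟩
    rw [setIntegral_congr_fun hU.measurableSet hcongr, integral_add' hi i1, hint, zero_add]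
  have hgi : IntegrableOn (fun x => ‖gradient u x‖ ^ 2) U := by
    -- The sets `{u ≥ 2ε}` exhaust `U`, and `smoothStep ε` equals `1` on them, so `∫ f u` bounds the
    -- gradient integral uniformly.
    have hcov : AECover (volume.restrict U) atTop
        fun n : ℕ => {x ∈ U | 2 * (1 / ((n : ℝ) + 1)) ≤ u x} := by
      refine ⟨?_, fun n => (hc _ (by positivity)).isClosed.measurableSet⟩
      filter_upwards [ae_restrict_mem hU.measurableSet] with x hx
      have := (tendsto_one_div_add_atTop_nhds_zero_nat (𝕜 := ℝ)).const_mul 2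
      rw [mul_zero] at this
      filter_upwards [this.eventually_lt_const (hu0 x hx)] with n hn using ⟨hx, hn.le⟩
    refine hcov.integrable_of_integral_norm_bounded (∫ x in U, f x * u x) (fun n => ?_)
      (Eventually.of_forall fun n => ?_)
    · have hK := hc (2 * (1 / ((n : ℝ) + 1))) (by positivity)
      rw [IntegrableOn, Measure.restrict_restrict hK.isClosed.measurableSet,
        Set.inter_eq_left.2 (Set.sep_subset _ _)]
      exact (hgc.mono (Set.sep_subset _ _)).integrableOn_compact hK
    · have hε : 0 < 1 / ((n : ℝ) + 1) := by positivity
      have hK := hc (2 * (1 / ((n : ℝ) + 1))) (by positivity)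
      obtain ⟨i1, i2, e⟩ := key _ hε
      rw [Measure.restrict_restrict hK.isClosed.measurableSet,
        Set.inter_eq_left.2 (Set.sep_subset _ _)]
      calc ∫ x in {x ∈ U | 2 * (1 / ((n : ℝ) + 1)) ≤ u x}, ‖‖gradient u x‖ ^ 2‖
          = ∫ x in {x ∈ U | 2 * (1 / ((n : ℝ) + 1)) ≤ u x},
            smoothStep (1 / ((n : ℝ) + 1)) (u x) * ‖gradient u x‖ ^ 2 :=
            setIntegral_congr_fun hK.isClosed.measurableSet fun x hx => by
              simp only [smoothStep_eq_one hε hx.2, one_mul, norm_pow, norm_norm]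
        _ ≤ ∫ x in U, smoothStep (1 / ((n : ℝ) + 1)) (u x) * ‖gradient u x‖ ^ 2 :=
            setIntegral_mono_set i2 (Eventually.of_forall fun x =>
              mul_nonneg (smoothStep_nonneg _ _) (sq_nonneg _))
              (Eventually.of_forall (Set.sep_subset _ _))
        _ = _ := e
        _ ≤ ∫ x in U, f x * u x := setIntegral_mono_on i1 hfui hU.measurableSet fun x hx =>
            mul_le_mul_of_nonneg_left (primitive_smoothStep_le _ (hu0 x hx).le) (hf0 x hx)
  refine ⟨hgi, ?_⟩
  have hlow : ∀ ε > 0, (∫ x in U, f x * u x) - 2 * ε * ∫ x in U, f x ≤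
      ∫ x in U, ‖gradient u x‖ ^ 2 := by
    intro ε hε
    obtain ⟨i1, i2, e⟩ := key ε hε
    rw [← integral_const_mul, ← integral_sub hfui (hf.const_mul _)]
    calc _ ≤ ∫ x in U, f x * primitive (smoothStep ε) (u x) :=
          setIntegral_mono_on (hfui.sub (hf.const_mul _)) i1 hU.measurableSet fun x hx => by
            have := mul_le_mul_of_nonneg_left
              (sub_le_primitive_smoothStep hε (hu0 x hx).le) (hf0 x hx)
            simp only [Pi.sub_apply]
            linarith
      _ = _ := e.symm
      _ ≤ _ := setIntegral_mono_on i2 hgi hU.measurableSet fun x _ =>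
          mul_le_of_le_one_left (sq_nonneg _) (smoothStep_le_one _ _)
  have hcont : Tendsto (fun ε : ℝ => (∫ x in U, f x * u x) - 2 * ε * ∫ x in U, f x) (𝓝[>] 0)
      (𝓝 (∫ x in U, f x * u x)) := by
    have : Continuous fun ε : ℝ => (∫ x in U, f x * u x) - 2 * ε * ∫ x in U, f x := by fun_prop
    simpa using (this.tendsto 0).mono_left nhdsWithin_le_nhds
  refine le_of_tendsto hcont ?_
  filter_upwards [self_mem_nhdsWithin] with ε hε using hlow ε hε

end EnergyInequality

/-! ### Integrability and the energy inequality for Hénon solutions. -/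

section HenonSolution

variable {u : EuclideanSpace ℝ (Fin 2) → ℝ} {α p : ℝ}

theorem isOpen_unitDisc : IsOpen unitDisc := Metric.isOpen_ball

theorem closure_unitDisc : closure unitDisc = Metric.closedBall 0 1 :=
  closure_ball 0 one_ne_zero

namespace IsHenonSolution

theorem neg (hu : IsHenonSolution α p u) : IsHenonSolution α p (-u) where
  contDiffOn := hu.contDiffOn.neg
  continuousOn := hu.continuousOn.neg
  equation x hx := by
    rw [InnerProductSpace.laplacian_neg, Pi.neg_apply, hu.equation x hx |> neg_eq_iff_eq_neg.1]
    simp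
  boundary x hx := by simp [hu.boundary x hx]

theorem isCompact_superlevel (hu : IsHenonSolution α p u) {ε : ℝ} (hε : 0 < ε) :
    IsCompact {x ∈ unitDisc | ε ≤ u x} := by
  have hcl : IsCompact (closure unitDisc) := by
    rw [closure_unitDisc]
    exact isCompact_closedBall 0 1
  -- The boundary condition keeps the level `ε > 0` away from the unit circle.
  have he : {x ∈ unitDisc | ε ≤ u x} = closure unitDisc ∩ u ⁻¹' Set.Ici ε := by
    ext x
    refine ⟨fun h => ⟨subset_closure h.1, h.2⟩, fun h => ⟨?_, h.2⟩⟩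
    by_contra hx
    have hfr : x ∈ frontier unitDisc := by
      rw [frontier, isOpen_unitDisc.interior_eq]
      exact ⟨h.1, hx⟩
    have h2 : ε ≤ u x := h.2
    rw [hu.boundary x hfr] at h2
    linarith
  rw [he]
  exact hcl.of_isClosed_subset
    (hu.continuousOn.preimage_isClosed_of_isClosed isClosed_closure isClosed_Ici)
    Set.inter_subset_left

theorem exists_bound (hu : IsHenonSolution α p u) : ∃ b, ∀ x ∈ unitDisc, |u x| ≤ b := by
  have hcl : IsCompact (closure unitDisc) := by
    rw [closure_unitDisc]
    exact isCompact_closedBall 0 1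
  obtain ⟨b, hb⟩ := hcl.exists_bound_of_continuousOn hu.continuousOn
  exact ⟨b, fun x hx => hb x (subset_closure hx)⟩

theorem equation_of_pos (hu : IsHenonSolution α p u) {x : EuclideanSpace ℝ (Fin 2)}
    (hx : x ∈ unitDisc) (h : 0 < u x) : -(Laplacian.laplacian u x) = ‖x‖ ^ α * u x ^ p := by
  rw [hu.equation x hx, abs_of_pos h, mul_assoc, ← Real.rpow_add_one h.ne', sub_add_cancel]

theorem integrableOn_of_continuous_comp (hu : IsHenonSolution α p u) (hα : 0 ≤ α) {h : ℝ → ℝ}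
    (hh : Continuous h) {U : Set (EuclideanSpace ℝ (Fin 2))} (hU : U ⊆ unitDisc) :
    IntegrableOn (fun x => ‖x‖ ^ α * h (u x)) U := by
  obtain ⟨b, hb⟩ := hu.exists_bound
  obtain ⟨C, hC⟩ := (isCompact_Icc (a := -b) (b := b)).exists_bound_of_continuousOn hh.continuousOn
  have hcα : Continuous fun x : EuclideanSpace ℝ (Fin 2) => ‖x‖ ^ α :=
    continuous_norm.rpow_const fun _ => Or.inr hα
  refine (integrableOn_of_continuousOn_of_bounded (C := 1 * C) isOpen_unitDisc subset_rfl
    (hcα.continuousOn.mul (hh.comp_continuousOn hu.contDiffOn.continuousOn)) fun x hx => ?_).mono_set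
      hU
  simp only [Pi.mul_apply, Function.comp_apply, abs_mul]
  refine mul_le_mul ?_ (hC _ (abs_le.1 (hb x hx))) (abs_nonneg _) zero_le_one
  rw [abs_of_nonneg (by positivity)]
  exact Real.rpow_le_one (norm_nonneg x) (mem_ball_zero_iff.1 hx).le hα

theorem integrableOn_energy_density (hu : IsHenonSolution α p u) (hα : 0 ≤ α) (hp : 1 < p)
    {U : Set (EuclideanSpace ℝ (Fin 2))} (hU : U ⊆ unitDisc) :
    IntegrableOn (fun x => ‖x‖ ^ α * |u x| ^ (p + 1)) U :=
  hu.integrableOn_of_continuous_comp hα (h := fun t => |t| ^ (p + 1))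
    (continuous_abs.rpow_const fun _ => Or.inr (by linarith)) hU

theorem positive_part (hu : IsHenonSolution α p u) (hα : 0 ≤ α) (hp : 1 < p) :
    IntegrableOn (fun x => ‖gradient u x‖ ^ 2) {x ∈ unitDisc | 0 < u x} ∧
      ∫ x in {x ∈ unitDisc | 0 < u x}, ‖x‖ ^ α * |u x| ^ (p + 1) ≤
        ∫ x in {x ∈ unitDisc | 0 < u x}, ‖gradient u x‖ ^ 2 := by
  have hU : IsOpen {x ∈ unitDisc | 0 < u x} :=
    hu.contDiffOn.continuousOn.isOpen_inter_preimage isOpen_unitDisc isOpen_Ioi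
  have hsub : {x ∈ unitDisc | 0 < u x} ⊆ unitDisc := Set.sep_subset _ _
  have hcongr : Set.EqOn (fun x => ‖x‖ ^ α * |u x| ^ (p + 1)) (fun x => ‖x‖ ^ α * u x ^ p * u x)
      {x ∈ unitDisc | 0 < u x} := fun x hx => by
    simp only [abs_of_pos hx.2, Real.rpow_add_one hx.2.ne', mul_assoc]
  rw [setIntegral_congr_fun hU.measurableSet hcongr]
  refine integrableOn_gradient_sq_of_pos hU (hu.contDiffOn.mono hsub) (fun x hx => hx.2)
    (fun ε hε => ?_) ?_ ?_ (fun x hx => ?_) (fun x hx => hu.equation_of_pos hx.1 hx.2)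
  · convert hu.isCompact_superlevel hε using 1
    ext x
    exact ⟨fun h => ⟨h.1.1, h.2⟩, fun h => ⟨⟨h.1, hε.trans_le h.2⟩, h.2⟩⟩
  · exact hu.integrableOn_of_continuous_comp hα (h := fun t => t ^ p)
      (continuous_id.rpow_const fun _ => Or.inr (by linarith)) hsub
  · exact (integrableOn_congr_fun hcongr hU.measurableSet).1
      (hu.integrableOn_energy_density hα hp hsub)
  · have := hx.2
    positivity

/-- The positive-part estimate for `u` and `-u` covers `{u ≠ 0}`; on `{u = 0}`, possibly of positive
measure a priori, the gradient vanishes almost everywhere. -/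
theorem dirichlet_energy (hu : IsHenonSolution α p u) (hα : 0 ≤ α) (hp : 1 < p) :
    IntegrableOn (fun x => ‖gradient u x‖ ^ 2) unitDisc ∧
      ∫ x in unitDisc, ‖x‖ ^ α * |u x| ^ (p + 1) ≤ ∫ x in unitDisc, ‖gradient u x‖ ^ 2 := by
  set P := {x ∈ unitDisc | 0 < u x} with hP
  set Q := {x ∈ unitDisc | u x < 0} with hQ
  set Z := {x ∈ unitDisc | u x = 0} with hZ
  have hcont := hu.contDiffOn.continuousOn
  have hPm : MeasurableSet P :=
    (hcont.isOpen_inter_preimage isOpen_unitDisc isOpen_Ioi).measurableSet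
  have hQm : MeasurableSet Q :=
    (hcont.isOpen_inter_preimage isOpen_unitDisc isOpen_Iio).measurableSet
  have hunion : unitDisc = P ∪ Q ∪ Z := by
    ext x
    simp only [hP, hQ, hZ, Set.mem_union, Set.mem_ofPred_eq]
    rcases lt_trichotomy (u x) 0 with h | h | h <;> tauto
  have hPQ : Disjoint P Q := Set.disjoint_left.2 fun x h1 h2 => lt_asymm h1.2 h2.2
  have hPQZ : Disjoint (P ∪ Q) Z := Set.disjoint_left.2 fun x h1 h2 =>
    h1.elim (fun h => h.2.ne' h2.2) (fun h => h.2.ne h2.2)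
  have hZm : MeasurableSet Z := by
    have : Z = unitDisc \ (P ∪ Q) := by
      rw [hunion, Set.union_sdiff_left, hPQZ.symm.sdiff_eq_left]
    rw [this]
    exact isOpen_unitDisc.measurableSet.diff (hPm.union hQm)
  have hZ0 : ∀ᵐ x ∂volume.restrict Z, ‖gradient u x‖ ^ 2 = 0 := by
    filter_upwards [ae_gradient_eq_zero_of_eqOn_zero hZm (fun x hx =>
      (hu.contDiffOn.contDiffAt (isOpen_unitDisc.mem_nhds hx.1)).differentiableAt (by simp))
      fun x hx => hx.2] with x hx
    simp [hx]
  have hgneg : ∀ x, ‖gradient (-u) x‖ ^ 2 = ‖gradient u x‖ ^ 2 := fun x => by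
    simp [gradient, fderiv_neg]
  obtain ⟨pi, pl⟩ := hu.positive_part hα hp
  obtain ⟨qi, ql⟩ := hu.neg.positive_part hα hp
  simp only [hgneg, Pi.neg_apply, abs_neg, Left.neg_pos_iff] at qi ql
  have zi : IntegrableOn (fun x => ‖gradient u x‖ ^ 2) Z :=
    (integrable_congr (g := fun _ => (0 : ℝ)) hZ0).2 (integrable_zero _ _ _)
  have zg : ∫ x in Z, ‖gradient u x‖ ^ 2 = 0 := integral_eq_zero_of_ae hZ0
  have zu : ∫ x in Z, ‖x‖ ^ α * |u x| ^ (p + 1) = 0 := by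
    refine setIntegral_eq_zero_of_forall_eq_zero fun x hx => ?_
    rw [hx.2, abs_zero, Real.zero_rpow (by linarith), mul_zero]
  have ei : ∀ {S}, S ⊆ unitDisc → IntegrableOn (fun x => ‖x‖ ^ α * |u x| ^ (p + 1)) S :=
    fun h => hu.integrableOn_energy_density hα hp h
  rw [hunion]
  refine ⟨(pi.union qi).union zi, ?_⟩
  rw [setIntegral_union hPQZ hZm ((pi.union qi)) zi, setIntegral_union hPQ hQm pi qi,
    setIntegral_union hPQZ hZm (ei (by rw [hunion]; exact Set.subset_union_left))
      (ei (Set.sep_subset _ _)),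
    setIntegral_union hPQ hQm (ei (Set.sep_subset _ _)) (ei (Set.sep_subset _ _)), zg, zu]
  linarith

end IsHenonSolution

end HenonSolution

/-! ### Nodal regions, summation of their energies and asymptotics. -/

section NodalRegions

/-- The other components of `S` have open union, so the intersection is `K` minus an open set. -/
theorem isCompact_connectedComponentIn_inter {X : Type*} [TopologicalSpace X]
    [LocallyConnectedSpace X] {S K : Set X} (hS : IsOpen S) (hK : IsCompact K) (hKS : K ⊆ S)
    (x : X) : IsCompact (connectedComponentIn S x ∩ K) := by
  have hV : IsOpen (⋃ y ∈ S \ connectedComponentIn S x, connectedComponentIn S y) :=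
    isOpen_biUnion fun y _ => hS.connectedComponentIn
  convert hK.diff hV using 1
  ext z
  constructor
  · rintro ⟨hz, hzK⟩
    refine ⟨hzK, fun hzV => ?_⟩
    obtain ⟨y, hy, hzy⟩ := Set.mem_iUnion₂.1 hzV
    apply hy.2
    rw [connectedComponentIn_eq hz, ← connectedComponentIn_eq hzy]
    exact mem_connectedComponentIn hy.1
  · rintro ⟨hzK, hzV⟩
    refine ⟨?_, hzK⟩
    by_contra hz
    exact hzV (Set.mem_iUnion₂.2 ⟨z, ⟨hKS hzK, hz⟩, mem_connectedComponentIn (hKS hzK)⟩)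

variable {u : EuclideanSpace ℝ (Fin 2) → ℝ} {α p : ℝ}

theorem pairwiseDisjoint_nodalRegions : (nodalRegions u).PairwiseDisjoint id := by
  rintro _ ⟨x, -, rfl⟩ _ ⟨y, -, rfl⟩ hne
  refine Set.disjoint_left.2 fun z hx hy => hne ?_
  rw [connectedComponentIn_eq hx, connectedComponentIn_eq hy]

namespace IsHenonSolution

theorem isOpen_ne_zero (hu : IsHenonSolution α p u) : IsOpen {y ∈ unitDisc | u y ≠ 0} :=
  hu.contDiffOn.continuousOn.isOpen_inter_preimage isOpen_unitDisc isOpen_ne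

theorem isOpen_of_mem_nodalRegions (hu : IsHenonSolution α p u)
    {Ω : Set (EuclideanSpace ℝ (Fin 2))} (hΩ : Ω ∈ nodalRegions u) : IsOpen Ω := by
  obtain ⟨x, -, rfl⟩ := hΩ
  exact hu.isOpen_ne_zero.connectedComponentIn

theorem log_energy_of_pos_on (hu : IsHenonSolution α p u) (hα : 0 ≤ α) (hp : 1 < p) {s : ℝ}
    (hs : 0 < s) (hs2 : s < 2) {x : EuclideanSpace ℝ (Fin 2)}
    (hx : x ∈ {y ∈ unitDisc | u y ≠ 0})
    (hpos : ∀ y ∈ connectedComponentIn {y ∈ unitDisc | u y ≠ 0} x, 0 < u y) :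
    0 < ∫ y in connectedComponentIn {y ∈ unitDisc | u y ≠ 0} x, ‖y‖ ^ α * |u y| ^ (p + 1) ∧
    (p + 1) / 2 * (Real.log (4 * Real.pi * s) + 1) ≤
      (p - 1) / 2 * Real.log ((p + 1) *
        ∫ y in connectedComponentIn {y ∈ unitDisc | u y ≠ 0} x, ‖y‖ ^ α * |u y| ^ (p + 1)) +
        Real.log (p + 1) + entropyConst s := by
  have hΩo := hu.isOpen_ne_zero.connectedComponentIn (x := x)
  have hsub : connectedComponentIn {y ∈ unitDisc | u y ≠ 0} x ⊆ unitDisc :=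
    (connectedComponentIn_subset _ _).trans (Set.sep_subset _ _)
  obtain ⟨b, hb⟩ := hu.exists_bound
  rw [setIntegral_congr_fun (g := fun y => ‖y‖ ^ α * u y ^ (p + 1)) hΩo.measurableSet
    fun y hy => by simp only [abs_of_pos (hpos y hy)]]
  refine log_setIntegral_lower_bound hα hp hs hs2 hΩo ⟨x, mem_connectedComponentIn hx⟩ hsub
    (hu.contDiffOn.mono hsub) hpos (fun ε hε => ?_)
    (fun y hy => (le_abs_self _).trans (hb y (hsub hy)))
    fun y hy => hu.equation_of_pos (hsub hy) (hpos y hy)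
  convert isCompact_connectedComponentIn_inter hu.isOpen_ne_zero (hu.isCompact_superlevel hε)
    (fun y hy => ⟨hy.1, (hε.trans_le hy.2).ne'⟩) x using 1
  ext y
  exact ⟨fun h => ⟨h.1, hsub h.1, h.2⟩, fun h => ⟨h.1, h.2.2⟩⟩

theorem log_energy_nodalRegion (hu : IsHenonSolution α p u) (hα : 0 ≤ α) (hp : 1 < p) {s : ℝ}
    (hs : 0 < s) (hs2 : s < 2) {Ω : Set (EuclideanSpace ℝ (Fin 2))} (hΩ : Ω ∈ nodalRegions u) :
    0 < ∫ y in Ω, ‖y‖ ^ α * |u y| ^ (p + 1) ∧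
    (p + 1) / 2 * (Real.log (4 * Real.pi * s) + 1) ≤
      (p - 1) / 2 * Real.log ((p + 1) * ∫ y in Ω, ‖y‖ ^ α * |u y| ^ (p + 1)) +
        Real.log (p + 1) + entropyConst s := by
  obtain ⟨x, hx, rfl⟩ := hΩ
  set Ω := connectedComponentIn {y ∈ unitDisc | u y ≠ 0} x with hΩ
  have hsub : Ω ⊆ {y ∈ unitDisc | u y ≠ 0} := connectedComponentIn_subset _ _
  have hxΩ : x ∈ Ω := mem_connectedComponentIn hx
  have hc : ContinuousOn u Ω := hu.contDiffOn.continuousOn.mono fun y hy => (hsub hy).1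
  have hpre : IsPreconnected Ω := isPreconnected_connectedComponentIn
  rcases lt_or_gt_of_ne hx.2 with h | h
  · have hneg : ∀ y ∈ Ω, u y < 0 := by
      intro y hy
      by_contra h'
      obtain ⟨z, hz, hz0⟩ := hpre.intermediate_value hxΩ hy hc ⟨h.le, not_lt.1 h'⟩
      exact (hsub hz).2 hz0
    have hS : {y ∈ unitDisc | (-u) y ≠ 0} = {y ∈ unitDisc | u y ≠ 0} := by
      simp only [Pi.neg_apply, neg_ne_zero]
    have := hu.neg.log_energy_of_pos_on hα hp hs hs2 (x := x) (by rwa [hS]) (by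
      rw [hS]
      exact fun y hy => neg_pos.2 (hneg y hy))
    rw [hS] at this
    simpa only [Pi.neg_apply, abs_neg] using this
  · refine hu.log_energy_of_pos_on hα hp hs hs2 hx fun y hy => ?_
    by_contra h'
    obtain ⟨z, hz, hz0⟩ := hpre.intermediate_value hy hxΩ hc ⟨not_lt.1 h', h.le⟩
    exact (hsub hz).2 hz0

end IsHenonSolution

/-- A lower bound for the logarithm of `(p + 1) ∫_Ω |x| ^ α |u| ^ (p + 1)` on a nodal region `Ω`;
it tends to `log (4 π s) + 1` as `p → ∞`. -/
noncomputable def logEnergyBound (s p : ℝ) : ℝ :=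
  ((p + 1) / 2 * (Real.log (4 * Real.pi * s) + 1) - Real.log (p + 1) - entropyConst s) /
    ((p - 1) / 2)

theorem tendsto_logEnergyBound (s : ℝ) :
    Tendsto (logEnergyBound s) atTop (𝓝 (Real.log (4 * Real.pi * s) + 1)) := by
  have h1 : Tendsto (fun p : ℝ => p - 1) atTop atTop := tendsto_atTop_add_const_right _ _ tendsto_id
  have h2 : Tendsto (fun p : ℝ => p + 1) atTop atTop := tendsto_atTop_add_const_right _ _ tendsto_id
  have hinv : Tendsto (fun p : ℝ => (p - 1)⁻¹) atTop (𝓝 0) := h1.inv_tendsto_atTop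
  have hr : Tendsto (fun p : ℝ => (p + 1) / (p - 1)) atTop (𝓝 1) := by
    have : Tendsto (fun p : ℝ => 1 + 2 * (p - 1)⁻¹) atTop (𝓝 (1 + 2 * 0)) :=
      tendsto_const_nhds.add (hinv.const_mul 2)
    rw [mul_zero, add_zero] at this
    refine this.congr' ?_
    filter_upwards [eventually_gt_atTop 1] with p hp
    have : p - 1 ≠ 0 := by linarith
    field_simp
    ring
  have hlog : Tendsto (fun p : ℝ => Real.log (p + 1) / (p + 1)) atTop (𝓝 0) := by
    have := Real.isLittleO_log_id_atTop.tendsto_div_nhds_zero.comp h2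
    simpa [Function.comp_def] using this
  have := ((hr.mul_const (Real.log (4 * Real.pi * s) + 1)).sub ((hlog.mul hr).const_mul 2)).sub
    (hinv.const_mul (2 * entropyConst s))
  simp only [one_mul, zero_mul, mul_zero, sub_zero] at this
  refine this.congr' ?_
  filter_upwards [eventually_gt_atTop 1] with p hp
  have h3 : p - 1 ≠ 0 := by linarith
  have h4 : p + 1 ≠ 0 := by linarith
  rw [logEnergyBound]
  field_simp

theorem tendsto_energy_prefactor :
    Tendsto (fun p : ℝ => p * (1 / 2 - 1 / (p + 1)) / (p + 1)) atTop (𝓝 (1 / 2)) := by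
  have h2 : Tendsto (fun p : ℝ => p + 1) atTop atTop := tendsto_atTop_add_const_right _ _ tendsto_id
  have hinv : Tendsto (fun p : ℝ => (p + 1)⁻¹) atTop (𝓝 0) := h2.inv_tendsto_atTop
  have := (hinv.const_sub 1).mul (hinv.const_sub (1 / 2))
  simp only [sub_zero, one_mul] at this
  refine this.congr' ?_
  filter_upwards [eventually_gt_atTop 1] with p hp
  have h4 : p + 1 ≠ 0 := by linarith
  field_simp
  ring

theorem IsHenonSolution.le_energy (hu : IsHenonSolution α p u) (hα : 0 ≤ α) (hp : 1 < p) {s : ℝ}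
    (hs : 0 < s) (hs2 : s < 2) {N : ℕ} (hN : (N : ℕ∞) ≤ (nodalRegions u).encard) :
    N * (p * (1 / 2 - 1 / (p + 1)) / (p + 1) * Real.exp (logEnergyBound s p)) ≤
      p * henonEnergy α p u := by
  have hp1 : 0 < p + 1 := by linarith
  -- There may be infinitely many regions; exactly `N` of them suffice, since the integrand is
  -- nonnegative on the rest.
  obtain ⟨t, ht, htN⟩ := Set.exists_subset_encard_eq hN
  have hfin : t.Finite := Set.finite_of_encard_eq_coe htN
  lift t to Finset (Set (EuclideanSpace ℝ (Fin 2))) using hfin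
  rw [Set.encard_coe_eq_coe_finsetCard, Nat.cast_inj] at htN
  have hsub : ∀ Ω ∈ t, Ω ⊆ unitDisc := fun Ω hΩ => by
    obtain ⟨x, -, rfl⟩ := ht hΩ
    exact (connectedComponentIn_subset _ _).trans (Set.sep_subset _ _)
  have hJ : ∀ Ω ∈ t, Real.exp (logEnergyBound s p) / (p + 1) ≤
      ∫ y in Ω, ‖y‖ ^ α * |u y| ^ (p + 1) := fun Ω hΩ => by
    obtain ⟨h0, h⟩ := hu.log_energy_nodalRegion hα hp hs hs2 (ht hΩ)
    rw [div_le_iff₀' hp1, ← Real.le_log_iff_exp_le (mul_pos hp1 h0), logEnergyBound,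
      div_le_iff₀ (by linarith)]
    linarith
  have hint := hu.integrableOn_energy_density hα hp (subset_refl unitDisc)
  have hsum : N * (Real.exp (logEnergyBound s p) / (p + 1)) ≤
      ∫ y in unitDisc, ‖y‖ ^ α * |u y| ^ (p + 1) := by
    calc N * (Real.exp (logEnergyBound s p) / (p + 1))
        = ∑ Ω ∈ t, Real.exp (logEnergyBound s p) / (p + 1) := by simp [htN]
      _ ≤ ∑ Ω ∈ t, ∫ y in Ω, ‖y‖ ^ α * |u y| ^ (p + 1) := Finset.sum_le_sum hJ
      _ = ∫ y in ⋃ Ω ∈ t, Ω, ‖y‖ ^ α * |u y| ^ (p + 1) :=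
        (integral_biUnion_finset (s := id) t
          (fun Ω hΩ => (hu.isOpen_of_mem_nodalRegions (ht hΩ)).measurableSet)
          (pairwiseDisjoint_nodalRegions.subset ht)
          (fun Ω hΩ => hint.mono_set (hsub Ω hΩ))).symm
      _ ≤ _ := setIntegral_mono_set hint (Eventually.of_forall fun y => by positivity)
        (Eventually.of_forall (Set.iUnion₂_subset hsub))
  have hd := (hu.dirichlet_energy hα hp).2
  have hc : 0 ≤ 1 / 2 - 1 / (p + 1) := by
    rw [sub_nonneg]
    exact one_div_le_one_div_of_le two_pos (by linarith)
  have hE : (1 / 2 - 1 / (p + 1)) * ∫ y in unitDisc, ‖y‖ ^ α * |u y| ^ (p + 1) ≤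
      henonEnergy α p u := by
    rw [henonEnergy]
    linarith
  calc _ = p * ((1 / 2 - 1 / (p + 1)) * (N * (Real.exp (logEnergyBound s p) / (p + 1)))) := by ring
    _ ≤ p * ((1 / 2 - 1 / (p + 1)) * ∫ y in unitDisc, ‖y‖ ^ α * |u y| ^ (p + 1)) := by gcongr
    _ ≤ _ := by gcongr

end NodalRegions

theorem corollary2p3 (α : ℝ) (hα : 0 ≤ α) (N : ℕ) (u : ℝ → EuclideanSpace ℝ (Fin 2) → ℝ)
    (hu : ∀ᶠ p in atTop, IsHenonSolution α p (u p))
    (hN : ∀ᶠ p in atTop, (N : ℕ∞) ≤ (nodalRegions (u p)).encard) :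
    (∀ᶠ p in atTop, IntegrableOn (fun x => ‖gradient (u p) x‖ ^ 2) unitDisc volume ∧
      IntegrableOn (fun x => ‖x‖ ^ α * |u p x| ^ (p + 1)) unitDisc volume) ∧
    ((4 * Real.pi * Real.exp 1 * N : ℝ) : EReal) ≤
      liminf (fun p : ℝ => ((p * henonEnergy α p (u p) : ℝ) : EReal)) atTop := by
  constructor
  · filter_upwards [hu, eventually_gt_atTop 1] with p hp h1
    exact ⟨(hp.dirichlet_energy hα h1).1, hp.integrableOn_energy_density hα h1 subset_rfl⟩
  have key : ∀ s : ℝ, 0 < s → s < 2 → ((N * (1 / 2 * (4 * Real.pi * s * Real.exp 1)) : ℝ) : EReal) ≤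
      liminf (fun p : ℝ => ((p * henonEnergy α p (u p) : ℝ) : EReal)) atTop := by
    intro s hs hs2
    have hlim := (tendsto_energy_prefactor.mul
      ((Real.continuous_exp.tendsto _).comp (tendsto_logEnergyBound s))).const_mul (N : ℝ)
    rw [Real.exp_add, Real.exp_log (by positivity)] at hlim
    rw [← (EReal.tendsto_coe.2 hlim).liminf_eq]
    refine liminf_le_liminf ?_
    filter_upwards [hu, hN, eventually_gt_atTop 1] with p hp hNp h1
    exact EReal.coe_le_coe_iff.2 (hp.le_energy hα h1 hs hs2 hNp)
  -- The limit `p → ∞` is taken at fixed `s < 2`, where the entropy constant is finite; only then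
  -- does `s` tend to `2`.
  have hlim : Tendsto (fun s : ℝ => ((N * (1 / 2 * (4 * Real.pi * s * Real.exp 1)) : ℝ) : EReal))
      (𝓝[<] 2) (𝓝 ((4 * Real.pi * Real.exp 1 * N : ℝ) : EReal)) := by
    refine EReal.tendsto_coe.2 ?_
    have : Continuous fun s : ℝ => (N * (1 / 2 * (4 * Real.pi * s * Real.exp 1)) : ℝ) := by fun_prop
    convert (this.tendsto 2).mono_left nhdsWithin_le_nhds using 2
    ring
  refine le_of_tendsto hlim ?_
  filter_upwards [Ioo_mem_nhdsLT (two_pos : (0 : ℝ) < 2)] with s hs using key s hs.1 hs.2
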